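/- Let $n,d$ be non-negative integers, $T\in(0,\infty)$, $p\in(1,\infty)$, $\mathbb T^d=(\mathbb R/2\pi\mathbb Z)^d$, $Q_T=\mathbb T^d\times[0,T)$ and $\overline{Q_T}=\mathbb T^d\times[0,T]$. Consider the system $$\partial_t A(u)+\sum_{\alpha=1}^d\partial_\alpha F_\alpha(u)=0,\qquad u=u(x,t)\in\mathbb R^n, \qquad (1)$$ where $A,F_\alpha:\mathbb R^n\to\mathbb R^n$ are $C^2$. Assume: (H1) $A$ is one-to-one and $\nabla A(u)$ is nonsingular for every $u\in\mathbb R^n$. (H2) There are $\eta\in C^2(\mathbb R^n;\mathbb R)$, $q_\alpha\in C^1(\mathbb R^n;\mathbb R)$ ($\alpha=1,\dots,d$) and $G\in C^1(\mathbb R^n;\mathbb R^n)$ with $\nabla\eta=G\cdot\nabla A$ and $\nabla q_\alpha=G\cdot\nabla F_\alpha$. (H3) $\xi\cdot\big(\nabla^2\eta(u)-G(u)\cdot\nabla^2A(u)\big)\xi>0$ for all $u\in\mathbb R^n$ and $\xi\in\mathbb R^n\setminus\{0\}$, where $G\cdot\nabla^2A=\sum_kG_k\nabla^2A_k$. Assume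 further that $\eta\ge0$ and that (A1) $\beta_1(|u|^p+1)-B\le\eta(u)\le\beta_2(|u|^p+1)$ for all $u\in\mathbb R^n$, with some positive constants $\beta_1,\beta_2,B$; (A2) $|F_\alpha(u)|/\eta(u)\to0$ as $|u|\to\infty$, for every $\alpha$; (A3) $|A(u)|/\eta(u)\to0$ as $|u|\to\infty$; (A4) $\frac1C(|A(u)|^r+1)-B'\le\eta(u)\le C(|A(u)|^r+1)$ for all $u\in\mathbb R^n$, with some $r>1$ and $C,B'>0$. Let $u\in C([0,T];L^p(\mathbb T^d;\mathbb R^n))$, with the exponent $p$ of (A1), be an entropy weak solution of (1): $u$ satisfies (1), and $\partial_t\eta(u)+\sum_\alpha\partial_\alpha q_\alpha(u)\le0$, in the sense of distributions on $\mathbb T^d\times(0,T)$ (where the functions $A(u),F_\alpha(u),\eta(u),q_\alpha(u)$ are locally integrable). Let $\bar u\in W^{1,\infty}(\overline{Q_T};\mathbb R^n)$ (weak first derivatives in $L^\infty$; $\bar u$ denotes the representative that is continuous on $\overline{Q_T}$) be a strong solution of (1), i.e. $\nabla A(\bar u)\,\partial_t\bar u+\sum_\alpha\nabla F_\alpha(\bar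 u)\,\partial_\alpha\bar u=0$ almost everywhere on $Q_T$. Let $u_0=u(\cdot,0)$ and $\bar u_0=\bar u(\cdot,0)$ be the initial data. If $u_0=\bar u_0$ almost everywhere on $\mathbb T^d$, then $u=\bar u$ almost everywhere on $Q_T$. -/

import Mathlib

open MeasureTheory Set Filter Topology
open scoped ContDiff

noncomputable section

namespace HypCL

/-- The state space `ℝⁿ` with its Euclidean norm. -/
abbrev State (n : ℕ) : Type := EuclideanSpace ℝ (Fin n)

instance factTwoPiPos : Fact (0 < 2 * Real.pi) := ⟨Real.two_pi_pos⟩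

/-- The torus `𝕋ᵈ = (ℝ / 2πℤ)ᵈ`; its `volume` is the product of the Lebesgue measures, of total
mass `(2π)ᵈ`. -/
abbrev Torus (d : ℕ) : Type := Fin d → AddCircle (2 * Real.pi)

/-- The quotient map `ℝᵈ → 𝕋ᵈ`. -/
def toTorus {d : ℕ} (x : Fin d → ℝ) : Torus d := fun i => (x i : AddCircle (2 * Real.pi))

/-- The space-time cylinder `[0,T) × 𝕋ᵈ` (time is the first coordinate). -/
def cyl (d : ℕ) (T : ℝ) : Set (ℝ × Torus d) := Ico 0 T ×ˢ univ

/-- The open cylinder `(0,T) × 𝕋ᵈ`. -/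
def openCyl (d : ℕ) (T : ℝ) : Set (ℝ × Torus d) := Ioo 0 T ×ˢ univ

/-- The closed cylinder `[0,T] × 𝕋ᵈ`. -/
def closedCyl (d : ℕ) (T : ℝ) : Set (ℝ × Torus d) := Icc 0 T ×ˢ univ

/-- Classical partial derivative in time. -/
def dt {d : ℕ} (φ : ℝ × Torus d → ℝ) (z : ℝ × Torus d) : ℝ :=
  deriv (fun s : ℝ => φ (s, z.2)) z.1

/-- Classical partial derivative in the space direction `α`, taken along the translations of the
torus in the `α`-th coordinate. -/
def dx {d : ℕ} (α : Fin d) (φ : ℝ × Torus d → ℝ) (z : ℝ × Torus d) : ℝ :=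
  deriv (fun h : ℝ => φ (z.1, z.2 + toTorus (Pi.single α h))) 0

/-- Test functions `φ ∈ C_c^∞((0,T) × 𝕋ᵈ)`. Smoothness is that of the lift to `ℝ × ℝᵈ`; the
torus being compact, compact support is a condition on time only. -/
structure IsTest {d : ℕ} (T : ℝ) (φ : ℝ × Torus d → ℝ) : Prop where
  smooth : ContDiff ℝ ∞ (fun y : ℝ × (Fin d → ℝ) => φ (y.1, toTorus y.2))
  supp : ∃ a b : ℝ, 0 < a ∧ b < T ∧ ∀ z : ℝ × Torus d, z.1 ∉ Icc a b → φ z = 0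

/-- `w` is the weak time derivative of `v` on `(0,T) × 𝕋ᵈ`. -/
def IsWeakDt {d n : ℕ} (T : ℝ) (v w : ℝ × Torus d → State n) : Prop :=
  ∀ φ : ℝ × Torus d → ℝ, IsTest T φ →
    ∫ z in cyl d T, dt φ z • v z = - ∫ z in cyl d T, φ z • w z

/-- `w` is the weak derivative of `v` in the space direction `α` on `(0,T) × 𝕋ᵈ`. -/
def IsWeakDx {d n : ℕ} (T : ℝ) (α : Fin d) (v w : ℝ × Torus d → State n) : Prop :=
  ∀ φ : ℝ × Torus d → ℝ, IsTest T φ →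
    ∫ z in cyl d T, dx α φ z • v z = - ∫ z in cyl d T, φ z • w z

/-- `v ∈ C([0,T]; L^p(𝕋ᵈ; ℝⁿ))`, for a representative `v` that is jointly measurable. -/
structure IsContLp {d n : ℕ} (T p : ℝ) (v : ℝ × Torus d → State n) : Prop where
  meas : AEStronglyMeasurable v (volume.restrict (cyl d T))
  memLp : ∀ t ∈ Icc 0 T, MemLp (fun x : Torus d => v (t, x)) (ENNReal.ofReal p) volume
  cont : ∀ s ∈ Icc 0 T,
    Tendsto (fun t : ℝ => eLpNorm (fun x : Torus d => v (t, x) - v (s, x)) (ENNReal.ofReal p) volume)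
      (𝓝[Icc 0 T] s) (𝓝 0)

/-- `u` is a weak solution of `∂ₜ A(u) + ∑_α ∂_α F_α(u) = 0` on `(0,T) × 𝕋ᵈ`, in the sense of
distributions. -/
structure IsWeakSolution {d n : ℕ} (T : ℝ) (A : State n → State n)
    (F : Fin d → State n → State n) (u : ℝ × Torus d → State n) : Prop where
  locInt_A : LocallyIntegrableOn (fun z => A (u z)) (openCyl d T)
  locInt_F : ∀ α, LocallyIntegrableOn (fun z => F α (u z)) (openCyl d T)
  eqn : ∀ φ : ℝ × Torus d → ℝ, IsTest T φ →
    ∫ z in cyl d T, (dt φ z • A (u z) + ∑ α, dx α φ z • F α (u z)) = 0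

/-- `u` is an entropy weak solution: a weak solution with
`∂ₜ η(u) + ∑_α ∂_α q_α(u) ≤ 0` on `(0,T) × 𝕋ᵈ`, in the sense of distributions. -/
structure IsEntropyWeakSolution {d n : ℕ} (T : ℝ) (A : State n → State n)
    (F : Fin d → State n → State n) (η : State n → ℝ) (q : Fin d → State n → ℝ)
    (u : ℝ × Torus d → State n) : Prop extends IsWeakSolution T A F u where
  locInt_η : LocallyIntegrableOn (fun z => η (u z)) (openCyl d T)
  locInt_q : ∀ α, LocallyIntegrableOn (fun z => q α (u z)) (openCyl d T)
  entropy : ∀ φ : ℝ × Torus d → ℝ, IsTest T φ → (∀ z, 0 ≤ φ z) →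
    0 ≤ ∫ z in cyl d T, (dt φ z * η (u z) + ∑ α, dx α φ z * q α (u z))

/-- `v ∈ W^{1,∞}` is a strong solution of `∂ₜ A(v) + ∑_α ∂_α F_α(v) = 0`: it is essentially bounded,
has essentially bounded weak first derivatives, which satisfy the equation (in its chain rule form)
almost everywhere, and `v` denotes the representative that is continuous up to `t = 0` and `t = T`,
so that its initial values are `v (0, ·)`. -/
structure IsStrongSolution {d n : ℕ} (T : ℝ) (A : State n → State n)
    (F : Fin d → State n → State n) (v : ℝ × Torus d → State n) : Prop where
  cont : ContinuousOn v (closedCyl d T)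
  bdd : MemLp v ⊤ (volume.restrict (cyl d T))
  eqn : ∃ (wt : ℝ × Torus d → State n) (wx : Fin d → ℝ × Torus d → State n),
    MemLp wt ⊤ (volume.restrict (cyl d T)) ∧ IsWeakDt T v wt ∧
    (∀ α, MemLp (wx α) ⊤ (volume.restrict (cyl d T)) ∧ IsWeakDx T α v (wx α)) ∧
    ∀ᵐ z ∂(volume.restrict (cyl d T)),
      fderiv ℝ A (v z) (wt z) + ∑ α, fderiv ℝ (F α) (v z) (wx α z) = 0

/-- `(η, q)` is an entropy pair for `(A, F)` with multiplier `G`: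
`∇η = G · ∇A` and `∇q_α = G · ∇F_α`. -/
structure IsEntropyPair {d n : ℕ} (A : State n → State n) (F : Fin d → State n → State n)
    (η : State n → ℝ) (q : Fin d → State n → ℝ) (G : State n → State n) : Prop where
  smooth_η : ContDiff ℝ 2 η
  smooth_q : ∀ α, ContDiff ℝ 1 (q α)
  smooth_G : ContDiff ℝ 1 G
  grad_η : ∀ u ξ, fderiv ℝ η u ξ = inner ℝ (G u) (fderiv ℝ A u ξ)
  grad_q : ∀ α u ξ, fderiv ℝ (q α) u ξ = inner ℝ (G u) (fderiv ℝ (F α) u ξ)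

end HypCL

end

open HypCL

/-! The proof is by relative entropy: `relEnt` is `H(u|v) = η(u) - η(v) - G(v)·(A(u) - A(v))`. The
growth bounds make `A` proper, so being an injective local diffeomorphism it has a global `C²`
inverse `S`. In the conserved variables `U = A(u)` the gradient of `η ∘ S` is `G ∘ S`, and its
Hessian is the form in (H3) transported by `DS`, hence positive definite. So `H` is the Bregman
distance of a strictly convex function: it is nonnegative and vanishes only for `u = v`. For `v` in
a compact set it also dominates the quadratic Taylor remainder of each `F_α ∘ S`: by strong
convexity when `u` is bounded, and because `F_α` and `A` are `o(η)` when `u` is large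
(`exists_norm_remainder_le_relEnt`).

From the entropy inequality for `u`, subtract the equation for `u` tested with `φ(t) G(ū)` and the
chain rules for `η - G·A` and `q_α - G·F_α` along `ū`. What remains is `φ' H - φ R`, with `R` linear
in the derivatives of `ū`. The bilinear forms `DGᵀDA` and `DGᵀDF_α` are symmetric, so the strong
equation for `ū` turns `R` into a pairing of `DG(ū) ∂_α ū` with those quadratic remainders, whence
`R ≥ -Λ H` (`integral_relEnt_nonneg`).

Grönwall's inequality, in the form of a choice of `φ`, then gives `H = 0`
(`setIntegral_slab_eq_zero`), provided the mean of `H` tends to zero as `t → 0`. This follows from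
continuity of `u` in `L^p`, equality of the initial data and `H ≤ ε + C|u - ū|^p`
(`exists_relEnt_le_rpow`).

Since `ū` is only Lipschitz, `φ(t) G(ū)` is not a test function. It is reached by two
mollifications: weak equations extend from smooth to `C¹` test functions, and `φ G(ū)` is a limit of
such functions with `ū` mollified (`HasWeakGrad.integral_mul_eq_zero`). -/

namespace HypCL

/-! ### Differential calculus and convolution on `ℝ × 𝕋ᵈ`. -/

section

/-- Space-time `ℝ × 𝕋ᵈ`. -/
abbrev ST (d : ℕ) : Type := ℝ × Torus d

instance instIsAddHaarMeasureST {d : ℕ} : (volume : Measure (ST d)).IsAddHaarMeasure :=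
  Measure.prod.instIsAddHaarMeasure (volume : Measure ℝ) (volume : Measure (Torus d))

/-- Regularity makes the continuous compactly supported functions dense in `L¹`. -/
instance instRegularST {d : ℕ} : (volume : Measure (ST d)).Regular :=
  Measure.Regular.of_sigmaCompactSpace_of_isLocallyFiniteMeasure _

theorem toTorus_add {d : ℕ} (x y : Fin d → ℝ) : toTorus (x + y) = toTorus x + toTorus y := by
  ext i; simp [toTorus]

theorem toTorus_zero {d : ℕ} : toTorus (0 : Fin d → ℝ) = 0 := by
  ext i; simp [toTorus]

/-- The covering map `ℝ × ℝᵈ → ℝ × 𝕋ᵈ`. -/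
noncomputable def cover {d : ℕ} (y : ℝ × (Fin d → ℝ)) : ST d := (y.1, toTorus y.2)

/-- Smoothness of test functions is defined on the cover; continuity descends from there because the
covering map is a quotient map. -/
theorem isOpenQuotientMap_cover {d : ℕ} : IsOpenQuotientMap (cover : ℝ × (Fin d → ℝ) → ST d) :=
  IsOpenQuotientMap.id.prodMap
    (IsOpenQuotientMap.piMap fun _ : Fin d => QuotientAddGroup.isOpenQuotientMap_mk)

/-- The `i`-th coordinate direction of the cover; `none` is time. -/
def coverDir {d : ℕ} : Option (Fin d) → ℝ × (Fin d → ℝ)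
  | none => (1, 0)
  | some α => (0, Pi.single α 1)

/-- Translations of space-time in the `i`-th coordinate direction; `none` is time. -/
noncomputable def dir {d : ℕ} (i : Option (Fin d)) (s : ℝ) : ST d := cover (s • coverDir i)

theorem cover_add {d : ℕ} (x y : ℝ × (Fin d → ℝ)) : cover (x + y) = cover x + cover y := by
  simp [cover, toTorus_add]

theorem dir_none {d : ℕ} (s : ℝ) : (dir none s : ST d) = (s, 0) := by
  simp [dir, coverDir, cover, toTorus_zero]

theorem dir_some {d : ℕ} (α : Fin d) (s : ℝ) : dir (some α) s = (0, toTorus (Pi.single α s)) := by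
  simp [dir, coverDir, cover, ← Pi.single_smul]

theorem dir_zero {d : ℕ} (i : Option (Fin d)) : (dir i 0 : ST d) = 0 := by
  simp [dir, cover, toTorus_zero]

theorem dir_add {d : ℕ} (i : Option (Fin d)) (s t : ℝ) :
    (dir i (s + t) : ST d) = dir i s + dir i t := by
  simp [dir, add_smul, cover_add]

theorem continuous_dir {d : ℕ} (i : Option (Fin d)) : Continuous (dir i : ℝ → ST d) :=
  isOpenQuotientMap_cover.continuous.comp (continuous_id.smul continuous_const)

variable {d : ℕ} {E E' : Type*} [NormedAddCommGroup E] [NormedSpace ℝ E]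
  [NormedAddCommGroup E'] [NormedSpace ℝ E']

/-- Partial derivative in the `i`-th coordinate direction; `none` is time. -/
noncomputable def dd (i : Option (Fin d)) (f : ST d → E) (z : ST d) : E :=
  deriv (fun s : ℝ => f (z + dir i s)) 0

theorem dd_none (φ : ST d → ℝ) : dd none φ = dt φ := by
  ext z
  have := deriv_comp_const_add (f := fun s : ℝ => φ (s, z.2)) z.1 0
  simp only [add_zero] at this
  rw [dd, dt, ← this]
  congr 1; ext s
  rw [dir_none]
  congr 1
  ext <;> simp

theorem dd_some (α : Fin d) (φ : ST d → ℝ) : dd (some α) φ = dx α φ := by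
  ext z
  rw [dd, dx]
  congr 1; ext s
  rw [dir_some]
  congr 1
  ext <;> simp

/-- Continuously differentiable functions on space-time. -/
structure IsC1 (f : ST d → E) : Prop where
  cont : Continuous f
  hasDerivAt_zero : ∀ i z, HasDerivAt (fun s : ℝ => f (z + dir i s)) (dd i f z) 0
  cont_dd : ∀ i, Continuous (dd i f)

/-- Exhibiting the candidate derivatives yields regularity and their values at once, whence the
paired conclusions of the calculus rules below. -/
theorem IsC1.mk' {f : ST d → E} (f' : Option (Fin d) → ST d → E) (hf : Continuous f)
    (h : ∀ i z, HasDerivAt (fun s : ℝ => f (z + dir i s)) (f' i z) 0)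
    (h' : ∀ i, Continuous (f' i)) : IsC1 f ∧ ∀ i, dd i f = f' i := by
  have e : ∀ i, dd i f = f' i := fun i => funext fun z => (h i z).deriv
  exact ⟨⟨hf, fun i z => by rw [e]; exact h i z, fun i => by rw [e]; exact h' i⟩, e⟩

theorem IsC1.hasDerivAt {f : ST d → E} (hf : IsC1 f) (i : Option (Fin d)) (z : ST d) (s : ℝ) :
    HasDerivAt (fun s : ℝ => f (z + dir i s)) (dd i f (z + dir i s)) s := by
  have h := hf.hasDerivAt_zero i (z + dir i s)
  have h2 : HasDerivAt (fun r : ℝ => f (z + dir i s + dir i (r - s))) (dd i f (z + dir i s)) s := by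
    have := HasDerivAt.comp_sub_const (x := s) (a := s)
      (f := fun r => f (z + dir i s + dir i r)) (f' := dd i f (z + dir i s)) (by simpa using h)
    exact this
  convert h2 using 2 with r
  rw [add_assoc, ← dir_add]; simp

theorem isC1_of_contDiff_cover {f : ST d → E} (hf : ContDiff ℝ 1 (fun y => f (cover y))) :
    IsC1 f := by
  have hD : ∀ i y, HasDerivAt (fun s : ℝ => f (cover y + dir i s))
      (fderiv ℝ (fun y => f (cover y)) y (coverDir i)) 0 := by
    intro i y
    have h1 : HasFDerivAt (fun y => f (cover y)) (fderiv ℝ (fun y => f (cover y)) y)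
        (y + (0 : ℝ) • coverDir i) := by
      simpa using (hf.differentiable (by norm_num) y).hasFDerivAt
    have h2 : HasDerivAt (fun s : ℝ => y + s • (coverDir i : ℝ × (Fin d → ℝ))) (coverDir i) 0 := by
      simpa using ((hasDerivAt_id (0 : ℝ)).smul_const (coverDir i : ℝ × (Fin d → ℝ))).const_add y
    have := h1.comp_hasDerivAt (0 : ℝ) h2
    simpa [Function.comp_def, cover_add, dir] using this
  have hd : ∀ i y, dd i f (cover y) = fderiv ℝ (fun y => f (cover y)) y (coverDir i) :=
    fun i y => (hD i y).deriv
  refine ⟨isOpenQuotientMap_cover.isQuotientMap.continuous_iff.2 hf.continuous, fun i z => ?_,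
    fun i => isOpenQuotientMap_cover.isQuotientMap.continuous_iff.2 ?_⟩
  · obtain ⟨y, rfl⟩ := isOpenQuotientMap_cover.surjective z
    rw [hd]; exact hD i y
  · have : dd i f ∘ cover = fun y => fderiv ℝ (fun y => f (cover y)) y (coverDir i) :=
      funext fun y => hd i y
    rw [this]
    exact (hf.continuous_fderiv (by norm_num)).clm_apply continuous_const

theorem IsTest.isC1 {T : ℝ} {φ : ST d → ℝ} (hφ : IsTest T φ) : IsC1 φ :=
  isC1_of_contDiff_cover (hφ.smooth.of_le (by exact_mod_cast le_top))

theorem IsC1.comp_contDiff {v : ST d → E} (hv : IsC1 v) {g : E → E'} (hg : ContDiff ℝ 1 g) :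
    IsC1 (fun z => g (v z)) ∧ ∀ i, dd i (fun z => g (v z)) = fun z => fderiv ℝ g (v z) (dd i v z) := by
  refine IsC1.mk' _ (hg.continuous.comp hv.cont) (fun i z => ?_) fun i => ?_
  · have h1 : HasFDerivAt g (fderiv ℝ g (v z)) (v (z + dir i 0)) := by
      simpa [dir_zero] using (hg.differentiable (by norm_num) (v z)).hasFDerivAt
    exact h1.comp_hasDerivAt (0 : ℝ) (hv.hasDerivAt_zero i z)
  · exact ((hg.continuous_fderiv (by norm_num)).comp hv.cont).clm_apply (hv.cont_dd i)

theorem IsC1.mul {f g : ST d → ℝ} (hf : IsC1 f) (hg : IsC1 g) :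
    IsC1 (fun z => f z * g z) ∧
      ∀ i, dd i (fun z => f z * g z) = fun z => dd i f z * g z + f z * dd i g z := by
  refine IsC1.mk' _ (hf.cont.mul hg.cont) (fun i z => ?_) fun i =>
    ((hf.cont_dd i).mul hg.cont).add (hf.cont.mul (hg.cont_dd i))
  have := (hf.hasDerivAt_zero i z).mul (hg.hasDerivAt_zero i z)
  simp only [dir_zero, add_zero] at this
  exact this

theorem isC1_time {φ : ℝ → ℝ} (hφ : ContDiff ℝ 1 φ) : IsC1 (fun z : ST d => φ z.1) ∧
    dd none (fun z : ST d => φ z.1) = (fun z => deriv φ z.1) ∧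
    ∀ α, dd (some α) (fun z : ST d => φ z.1) = fun _ => 0 := by
  refine ⟨isC1_of_contDiff_cover (hφ.comp contDiff_fst), ?_, fun α => ?_⟩
  · ext z
    simp [dd_none, dt]
  · ext z
    simp [dd_some, dx]

/-- `f` vanishes outside the times in `[a, b]`. -/
def TimeSupp (a b : ℝ) (f : ST d → E) : Prop := ∀ z, z.1 ∉ Icc a b → f z = 0

theorem TimeSupp.dd {a b : ℝ} {f : ST d → E} (hf : TimeSupp a b f) (i : Option (Fin d)) :
    TimeSupp a b (dd i f) := by
  intro z hz
  have hz' : ∀ᶠ s in 𝓝 (0 : ℝ), (z + dir i s).1 ∉ Icc a b := by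
    have hc : Continuous fun s : ℝ => (z + dir i s).1 :=
      continuous_fst.comp (continuous_const.add (continuous_dir i))
    exact hc.continuousAt.eventually_mem
      (isClosed_Icc.isOpen_compl.mem_nhds (by simpa [dir_zero] using hz))
  have : (fun s : ℝ => f (z + dir i s)) =ᶠ[𝓝 0] fun _ => (0 : E) := by
    filter_upwards [hz'] with s hs using hf _ hs
  rw [HypCL.dd, this.deriv_eq, deriv_const]

omit [NormedSpace ℝ E] in
theorem TimeSupp.mono {a b a' b' : ℝ} {f : ST d → E} (hf : TimeSupp a b f) (ha : a' ≤ a)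
    (hb : b ≤ b') : TimeSupp a' b' f := fun z hz => hf z fun h => hz ⟨ha.trans h.1, h.2.trans hb⟩

theorem isCompact_slab (a b : ℝ) : IsCompact (Icc a b ×ˢ (univ : Set (Torus d))) :=
  isCompact_Icc.prod isCompact_univ

-- The torus is compact, so only the extent in time matters.
omit [NormedSpace ℝ E] in
theorem TimeSupp.hasCompactSupport {a b : ℝ} {f : ST d → E} (hf : TimeSupp a b f) :
    HasCompactSupport f :=
  HasCompactSupport.of_support_subset_isCompact (isCompact_slab a b) fun z hz =>
    ⟨by by_contra h; exact hz (hf z h), mem_univ _⟩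

omit [NormedSpace ℝ E] in
theorem exists_timeSupp {f : ST d → E} (hf : HasCompactSupport f) :
    ∃ a b, TimeSupp a b f := by
  obtain ⟨R, hR⟩ := (hf.isCompact.image continuous_fst).isBounded.subset_closedBall 0
  refine ⟨-R, R, fun z hz => ?_⟩
  by_contra h
  have := hR (mem_image_of_mem _ (subset_tsupport _ h))
  rw [Real.closedBall_eq_Icc] at this
  exact hz (by simpa using this)

/-- Convolution on space-time. -/
noncomputable def conv (ρ : ST d → ℝ) (f : ST d → E) (z : ST d) : E := ∫ w, ρ (z - w) • f w

theorem conv_integrand_integrable {ρ : ST d → ℝ} (hρ : Continuous ρ) (hc : HasCompactSupport ρ)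
    {f : ST d → E} (hf : Integrable f) (z : ST d) : Integrable fun w => ρ (z - w) • f w := by
  obtain ⟨C, hC⟩ := hc.exists_bound_of_continuous hρ
  exact hf.bdd_smul C
    ((hρ.comp (continuous_const.sub continuous_id)).aestronglyMeasurable)
    (ae_of_all _ fun w => hC _)

theorem continuous_conv {ρ : ST d → ℝ} (hρ : Continuous ρ) (hc : HasCompactSupport ρ)
    {f : ST d → E} (hf : Integrable f) : Continuous (conv ρ f) := by
  obtain ⟨C, hC⟩ := hc.exists_bound_of_continuous hρ
  refine continuous_of_dominated (bound := fun w => C * ‖f w‖)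
    (fun z => (conv_integrand_integrable hρ hc hf z).aestronglyMeasurable)
    (fun z => ae_of_all _ fun w => ?_) (hf.norm.const_mul C) (ae_of_all _ fun w => by fun_prop)
  rw [norm_smul]
  exact mul_le_mul_of_nonneg_right (hC _) (norm_nonneg _)

/-- Differentiation under the integral puts the derivative on the kernel, so `f` need only be
integrable. -/
theorem IsC1.conv {ρ : ST d → ℝ} (hρ : IsC1 ρ) (hc : HasCompactSupport ρ) {f : ST d → E}
    (hf : Integrable f) : IsC1 (conv ρ f) ∧ ∀ i, dd i (HypCL.conv ρ f) = HypCL.conv (dd i ρ) f := by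
  obtain ⟨a, b, hab⟩ := exists_timeSupp hc
  have hci : ∀ i, HasCompactSupport (HypCL.dd i ρ) := fun i => (hab.dd i).hasCompactSupport
  refine IsC1.mk' _ (continuous_conv hρ.cont hc hf) (fun i z => ?_)
    fun i => continuous_conv (hρ.cont_dd i) (hci i) hf
  obtain ⟨C, hC⟩ := (hci i).exists_bound_of_continuous (hρ.cont_dd i)
  have key := hasDerivAt_integral_of_dominated_loc_of_deriv_le (𝕜 := ℝ) (μ := volume) (x₀ := 0)
    (s := univ) (F := fun s w => ρ (z + dir i s - w) • f w)
    (F' := fun s w => HypCL.dd i ρ (z + dir i s - w) • f w) (bound := fun w => C * ‖f w‖) univ_mem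
    (Eventually.of_forall fun s =>
      (conv_integrand_integrable hρ.cont hc hf _).aestronglyMeasurable)
    (conv_integrand_integrable hρ.cont hc hf _)
    (conv_integrand_integrable (hρ.cont_dd i) (hci i) hf _).aestronglyMeasurable
    (ae_of_all _ fun w s _ => by
      rw [norm_smul]; exact mul_le_mul_of_nonneg_right (hC _) (norm_nonneg _))
    (hf.norm.const_mul C)
    (ae_of_all _ fun w s _ => by
      have := (hρ.hasDerivAt i (z - w) s).smul_const (f w)
      simpa only [sub_add_eq_add_sub] using this)
  simpa [dir_zero, HypCL.conv] using key.2

theorem conv_comm (ρ f : ST d → ℝ) : conv ρ f = conv f ρ := by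
  ext z
  rw [conv, ← integral_sub_left_eq_self _ volume z]
  simp [conv, mul_comm]

/-- By translation invariance the integral of `f (z + dir i s)` does not depend on `s`;
differentiate it at `s = 0`. -/
theorem integral_dd_eq_zero {f : ST d → ℝ} (hf : IsC1 f) (hc : HasCompactSupport f)
    (i : Option (Fin d)) : ∫ z, dd i f z = 0 := by
  obtain ⟨a, b, hab⟩ := exists_timeSupp hc
  have hci : HasCompactSupport (HypCL.dd i f) := (hab.dd i).hasCompactSupport
  -- Shifts with `|s| < 1` move the time support by less than one, so a constant on `K` dominates
  -- all the shifted derivatives.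
  set K : Set (ST d) := Icc (a - 1) (b + 1) ×ˢ univ
  obtain ⟨C, hC⟩ := hci.exists_bound_of_continuous (hf.cont_dd i)
  have hfi : Integrable f := hf.cont.integrable_of_hasCompactSupport hc
  have key := hasDerivAt_integral_of_dominated_loc_of_deriv_le (𝕜 := ℝ) (μ := volume) (x₀ := 0)
    (s := Ioo (-1 : ℝ) 1) (F := fun s z => f (z + dir i s))
    (F' := fun s z => dd i f (z + dir i s)) (bound := K.indicator fun _ => C)
    (Ioo_mem_nhds (by norm_num) (by norm_num))
    (Eventually.of_forall fun s => (hf.cont.comp (by fun_prop)).aestronglyMeasurable)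
    (by simpa [dir_zero] using hfi)
    ((hf.cont_dd i).comp (by fun_prop)).aestronglyMeasurable
    (ae_of_all _ fun z s hs => by
      by_cases hz : z ∈ K
      · rw [indicator_of_mem hz]; exact hC _
      · rw [indicator_of_notMem hz, (hab.dd i) _ _, norm_zero]
        intro h
        refine hz ⟨?_, mem_univ _⟩
        have h1 : |(dir i s : ST d).1| ≤ 1 := by
          rw [abs_le]
          cases i with
          | none => rw [dir_none]; exact ⟨hs.1.le, hs.2.le⟩
          | some α => rw [dir_some]; norm_num
        rw [abs_le] at h1
        simp only [Prod.fst_add, mem_Icc] at h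
        exact ⟨by linarith, by linarith⟩)
    ((integrable_indicator_iff (isCompact_slab _ _).measurableSet).2
      (integrableOn_const (isCompact_slab _ _).measure_lt_top.ne))
    (ae_of_all _ fun z s _ => hf.hasDerivAt i z s)
  have h1 : (fun s : ℝ => ∫ z, f (z + dir i s)) = fun _ => ∫ z, f z :=
    funext fun s => integral_add_right_eq_self _ _
  have h2 := key.2
  rw [h1] at h2
  simpa [dir_zero] using h2.unique (hasDerivAt_const _ _)

end

/-! ### Mollifiers on space-time and `L¹` approximation. -/

section

variable {d : ℕ} {E : Type*} [NormedAddCommGroup E] [NormedSpace ℝ E]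

/-- The cosine on the circle `ℝ / 2πℤ`. -/
noncomputable def circleCos : AddCircle (2 * Real.pi) → ℝ := Real.cos_periodic.lift

theorem circleCos_coe (x : ℝ) : circleCos (x : AddCircle (2 * Real.pi)) = Real.cos x :=
  Real.cos_periodic.lift_coe x

theorem circleCos_le_one (x : AddCircle (2 * Real.pi)) : circleCos x ≤ 1 := by
  obtain ⟨r, rfl⟩ := QuotientAddGroup.mk_surjective x
  exact (circleCos_coe r).trans_le (Real.cos_le_one r)

theorem circleCos_neg (x : AddCircle (2 * Real.pi)) : circleCos (-x) = circleCos x := by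
  obtain ⟨r, rfl⟩ := QuotientAddGroup.mk_surjective x
  change circleCos (((-r : ℝ) : AddCircle (2 * Real.pi))) = circleCos (r : AddCircle (2 * Real.pi))
  rw [circleCos_coe, circleCos_coe, Real.cos_neg]

theorem eq_zero_of_circleCos_eq_one {x : AddCircle (2 * Real.pi)} (h : circleCos x = 1) :
    x = 0 := by
  obtain ⟨r, rfl⟩ := QuotientAddGroup.mk_surjective x
  obtain ⟨n, hn⟩ := (Real.cos_eq_one_iff r).1 ((circleCos_coe r).symm.trans h)
  exact (AddCircle.coe_eq_zero_iff _).2 ⟨n, by simpa using hn⟩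

/-- A smooth function on space-time, comparable to the squared distance to the origin. -/
noncomputable def spread (z : ST d) : ℝ := z.1 ^ 2 + ∑ i, (1 - circleCos (z.2 i))

theorem contDiff_spread_cover : ContDiff ℝ ∞ (fun y => spread (cover y : ST d)) := by
  have : (fun y => spread (cover y : ST d)) = fun y => y.1 ^ 2 + ∑ i, (1 - Real.cos (y.2 i)) := by
    ext y
    simp [spread, cover, toTorus, circleCos_coe]
  rw [this]
  fun_prop

theorem continuous_spread : Continuous (spread : ST d → ℝ) :=
  isOpenQuotientMap_cover.isQuotientMap.continuous_iff.2 contDiff_spread_cover.continuous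

theorem sq_le_spread (z : ST d) : z.1 ^ 2 ≤ spread z :=
  le_add_of_nonneg_right (Finset.sum_nonneg fun _ _ => sub_nonneg.2 (circleCos_le_one _))

theorem spread_neg (z : ST d) : spread (-z) = spread z := by
  simp [spread, circleCos_neg]

theorem spread_zero : spread (0 : ST d) = 0 := by
  have : circleCos 0 = 1 := by simpa using circleCos_coe 0
  simp [spread, this]

theorem eq_zero_of_spread_le_zero {z : ST d} (h : spread z ≤ 0) : z = 0 := by
  have h2 : 0 ≤ ∑ i, (1 - circleCos (z.2 i)) :=
    Finset.sum_nonneg fun i _ => sub_nonneg.2 (circleCos_le_one _)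
  have h3 := sq_nonneg z.1
  rw [spread] at h
  have h4 : ∑ i, (1 - circleCos (z.2 i)) = 0 := by linarith
  have h5 : z.1 ^ 2 = 0 := by linarith
  rw [Finset.sum_eq_zero_iff_of_nonneg fun i _ => sub_nonneg.2 (circleCos_le_one _)] at h4
  refine Prod.ext (by simpa using h5) (funext fun i => ?_)
  exact eq_zero_of_circleCos_eq_one (by linarith [h4 i (Finset.mem_univ i)])

/-- Off the interior of `U`, `spread` has a positive lower bound on the compact slab `|t| ≤ 1`;
beyond that slab it exceeds 1. -/
theorem exists_spread_lt_subset {U : Set (ST d)} (hU : U ∈ 𝓝 0) :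
    ∃ δ > 0, ∀ z, spread z < δ → z ∈ U := by
  have hK : IsCompact ((Icc (-1 : ℝ) 1 ×ˢ (univ : Set (Torus d))) \ interior U) :=
    (isCompact_slab _ _).diff isOpen_interior
  obtain ⟨m, hm, h⟩ := hK.exists_forall_le' (a := 0) continuous_spread.continuousOn
    (fun z hz => by
      by_contra h
      have := eq_zero_of_spread_le_zero (not_lt.1 h)
      exact hz.2 (this ▸ mem_interior_iff_mem_nhds.2 hU))
  refine ⟨min 1 m, lt_min one_pos hm, fun z hz => ?_⟩
  by_contra hzU
  have h1 : |z.1| ≤ 1 := by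
    rw [← sq_le_one_iff_abs_le_one]
    exact (sq_le_spread z).trans (hz.le.trans (min_le_left _ _))
  have := h z ⟨⟨abs_le.1 h1, mem_univ _⟩, fun h => hzU (interior_subset h)⟩
  exact absurd (hz.trans_le (min_le_right _ _)) (not_lt.2 this)

/-- An unnormalised bump function on space-time. -/
noncomputable def bump (k : ℕ) (z : ST d) : ℝ :=
  Real.smoothTransition (1 - spread z * (k + 1) ^ 2)

theorem contDiff_bump_cover (k : ℕ) : ContDiff ℝ ∞ (fun y => bump k (cover y : ST d)) :=
  Real.smoothTransition.contDiff.comp (contDiff_const.sub (contDiff_spread_cover.mul contDiff_const))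

theorem bump_eq_zero {k : ℕ} {z : ST d} (h : 1 / ((k : ℝ) + 1) ^ 2 ≤ spread z) : bump k z = 0 := by
  refine Real.smoothTransition.zero_of_nonpos ?_
  rw [div_le_iff₀ (by positivity)] at h
  linarith

theorem timeSupp_bump (k : ℕ) :
    TimeSupp (-(1 / ((k : ℝ) + 1))) (1 / ((k : ℝ) + 1)) (bump k : ST d → ℝ) := by
  intro z hz
  refine bump_eq_zero (le_trans ?_ (sq_le_spread z))
  rw [← one_div_pow]
  have h : ¬ |z.1| ≤ 1 / ((k : ℝ) + 1) := by rwa [abs_le]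
  rw [← sq_abs z.1]
  exact pow_le_pow_left₀ (by positivity) (not_le.1 h).le 2

theorem isC1_bump (k : ℕ) : IsC1 (bump k : ST d → ℝ) :=
  isC1_of_contDiff_cover ((contDiff_bump_cover k).of_le (by exact_mod_cast le_top))

theorem bump_nonneg (k : ℕ) (z : ST d) : 0 ≤ bump k z := Real.smoothTransition.nonneg _

theorem integral_bump_pos (k : ℕ) : 0 < ∫ z : ST d, bump k z := by
  refine (isC1_bump k).cont.integral_pos_of_hasCompactSupport_nonneg_nonzero
    (timeSupp_bump k).hasCompactSupport (bump_nonneg k) (x := 0) ?_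
  simp [bump, spread_zero]

/-- A sequence of smooth mollifiers on space-time. -/
noncomputable def moll (k : ℕ) (z : ST d) : ℝ := (∫ w : ST d, bump k w)⁻¹ * bump k z

theorem contDiff_moll_cover (k : ℕ) : ContDiff ℝ ∞ (fun y => moll k (cover y : ST d)) :=
  contDiff_const.mul (contDiff_bump_cover k)

theorem isC1_moll (k : ℕ) : IsC1 (moll k : ST d → ℝ) :=
  isC1_of_contDiff_cover ((contDiff_moll_cover k).of_le (by exact_mod_cast le_top))

theorem moll_nonneg (k : ℕ) (z : ST d) : 0 ≤ moll k z :=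
  mul_nonneg (inv_nonneg.2 (integral_bump_pos k).le) (bump_nonneg k z)

theorem timeSupp_moll (k : ℕ) :
    TimeSupp (-(1 / ((k : ℝ) + 1))) (1 / ((k : ℝ) + 1)) (moll k : ST d → ℝ) := fun z hz => by
  rw [moll, timeSupp_bump k z hz, mul_zero]

theorem hasCompactSupport_moll (k : ℕ) : HasCompactSupport (moll k : ST d → ℝ) :=
  (timeSupp_moll k).hasCompactSupport

theorem integrable_moll (k : ℕ) : Integrable (moll k : ST d → ℝ) :=
  (isC1_moll k).cont.integrable_of_hasCompactSupport (hasCompactSupport_moll k)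

theorem integral_moll (k : ℕ) : ∫ z : ST d, moll k z = 1 := by
  simp only [moll]
  rw [integral_const_mul, inv_mul_cancel₀ (integral_bump_pos k).ne']

/-- Evenness exchanges the convolution kernel `moll k (z - w)` with the test function `moll k (w -
z)`. -/
theorem moll_neg (k : ℕ) (z : ST d) : moll k (-z) = moll k z := by
  simp [moll, bump, spread_neg]

theorem eventually_moll_eq_zero {U : Set (ST d)} (hU : U ∈ 𝓝 0) :
    ∀ᶠ k : ℕ in atTop, ∀ z ∉ U, moll k z = 0 := by
  obtain ⟨δ, hδ, h⟩ := exists_spread_lt_subset hU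
  have h1 : Tendsto (fun k : ℕ => (1 / ((k : ℝ) + 1)) ^ 2) atTop (𝓝 0) := by
    simpa using (tendsto_one_div_add_atTop_nhds_zero_nat (𝕜 := ℝ)).pow 2
  filter_upwards [h1.eventually (gt_mem_nhds hδ)] with k hk z hz
  rw [moll, bump_eq_zero, mul_zero]
  rw [← one_div_pow]
  exact hk.le.trans (not_lt.1 fun h' => hz (h z h'))

theorem TimeSupp.conv {a b a' b' : ℝ} {ρ : ST d → ℝ} {f : ST d → E} (hρ : TimeSupp a b ρ)
    (hf : TimeSupp a' b' f) : TimeSupp (a + a') (b + b') (conv ρ f) := by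
  intro z hz
  refine integral_eq_zero_of_ae (ae_of_all _ fun w => ?_)
  by_cases h1 : w.1 ∈ Icc a' b'
  · by_cases h2 : (z - w).1 ∈ Icc a b
    · refine absurd ?_ hz
      simp only [Prod.fst_sub, mem_Icc] at h1 h2 ⊢
      exact ⟨by linarith, by linarith⟩
    · simp [hρ _ h2]
  · simp [hf _ h1]

theorem integral_moll_sub (k : ℕ) (z : ST d) : ∫ w : ST d, moll k (z - w) = 1 := by
  rw [integral_sub_left_eq_self (fun w => moll k w) volume z, integral_moll]

theorem integrable_moll_sub (k : ℕ) (z : ST d) : Integrable fun w : ST d => moll k (z - w) :=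
  (integrable_moll k).comp_sub_left z

theorem norm_conv_moll_le (k : ℕ) {f : ST d → E} {M : ℝ} (hM : ∀ᵐ w, ‖f w‖ ≤ M) (z : ST d) :
    ‖conv (moll k) f z‖ ≤ M := by
  have := norm_integral_le_of_norm_le (f := fun w => moll k (z - w) • f w)
    ((integrable_moll_sub k z).mul_const M) (by
      filter_upwards [hM] with w hw
      rw [norm_smul, Real.norm_of_nonneg (moll_nonneg _ _)]
      exact mul_le_mul_of_nonneg_left hw (moll_nonneg _ _))
  rwa [integral_mul_const, integral_moll_sub, one_mul] at this

theorem eventually_norm_conv_moll_sub_le [CompleteSpace E] {g : ST d → E} (hg : Continuous g)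
    (hc : HasCompactSupport g) {ε : ℝ} (hε : 0 < ε) :
    ∀ᶠ k : ℕ in atTop, ∀ z, ‖conv (moll k) g z - g z‖ ≤ ε := by
  have hu := hc.uniformContinuous_of_continuous hg
  have hU : {w : ST d | ∀ z, ‖g (z - w) - g z‖ ≤ ε} ∈ 𝓝 0 := by
    have h1 := hu (Metric.dist_mem_uniformity hε)
    rw [mem_map, uniformity_eq_comap_nhds_zero, mem_comap] at h1
    obtain ⟨V, hV, hVs⟩ := h1
    filter_upwards [hV] with w hw z
    have : ((z - w, z) : ST d × ST d) ∈ (fun x : ST d × ST d => x.2 - x.1) ⁻¹' V := by simpa using hw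
    have := hVs this
    simp only [mem_preimage, mem_ofPred_eq, dist_eq_norm] at this
    exact this.le
  filter_upwards [eventually_moll_eq_zero hU] with k hk z
  have e : conv (moll k) g z - g z = ∫ w, moll k (z - w) • (g w - g z) := by
    have h1 : ∫ w, moll k (z - w) • g z = g z := by
      rw [integral_smul_const, integral_moll_sub, one_smul]
    simp only [smul_sub]
    rw [integral_sub (conv_integrand_integrable (isC1_moll k).cont (hasCompactSupport_moll k)
      (hg.integrable_of_hasCompactSupport hc) z) ((integrable_moll_sub k z).smul_const _), h1, conv]
  rw [e]
  have := norm_integral_le_of_norm_le (f := fun w => moll k (z - w) • (g w - g z))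
    ((integrable_moll_sub k z).mul_const ε) (ae_of_all _ fun w => by
      rw [norm_smul, Real.norm_of_nonneg (moll_nonneg _ _)]
      by_cases hw : z - w ∈ {w : ST d | ∀ z, ‖g (z - w) - g z‖ ≤ ε}
      · refine mul_le_mul_of_nonneg_left ?_ (moll_nonneg _ _)
        simpa using hw z
      · rw [hk _ hw, zero_mul, zero_mul])
  rwa [integral_mul_const, integral_moll_sub, one_mul] at this

theorem integrable_conv_moll (k : ℕ) {f : ST d → E} (hf : Integrable f) :
    Integrable (conv (moll k) f) :=
  hf.integrable_convolution (ContinuousLinearMap.lsmul ℝ ℝ).flip (integrable_moll k)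

/-- Pointwise `|ρ * f| ≤ ρ * |f|`, and convolution with a kernel of mass one preserves the integral.
-/
theorem integral_norm_conv_moll_le (k : ℕ) {f : ST d → E} (hf : Integrable f) :
    ∫ z, ‖conv (moll k) f z‖ ≤ ∫ z, ‖f z‖ := by
  have h1 : ∫ z, conv (moll k) (fun w => ‖f w‖) z = ∫ z, ‖f z‖ := by
    have := integral_convolution (ContinuousLinearMap.lsmul ℝ ℝ : ℝ →L[ℝ] ℝ →L[ℝ] ℝ).flip
      hf.norm (integrable_moll (d := d) k)
    simpa [integral_moll, convolution, conv] using this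
  rw [← h1]
  refine integral_mono (integrable_conv_moll k hf).norm (integrable_conv_moll k hf.norm) fun z => ?_
  refine (norm_integral_le_integral_norm _).trans (le_of_eq ?_)
  simp [conv, norm_smul, abs_of_nonneg (moll_nonneg _ _)]

/-- For continuous compactly supported functions the convergence is uniform on a fixed slab; density
and the `L¹` contraction give the general case. -/
theorem tendsto_integral_norm_conv_moll_sub [CompleteSpace E] {f : ST d → E} (hf : Integrable f) :
    Tendsto (fun k : ℕ => ∫ z, ‖conv (moll k) f z - f z‖) atTop (𝓝 0) := by
  rw [Metric.tendsto_atTop']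
  suffices h : ∀ ε > 0, ∀ᶠ k : ℕ in atTop, ∫ z, ‖conv (moll k) f z - f z‖ ≤ 3 * ε by
    intro ε hε
    obtain ⟨N, hN⟩ := eventually_atTop.1 (h (ε / 6) (by positivity))
    refine ⟨N, fun k hk => ?_⟩
    rw [Real.dist_0_eq_abs, abs_of_nonneg (integral_nonneg fun _ => norm_nonneg _)]
    linarith [hN k hk.le]
  intro ε hε
  obtain ⟨g, hgc, hfg, hg, hgi⟩ := hf.exists_hasCompactSupport_integral_sub_le hε
  obtain ⟨a, b, hab⟩ := exists_timeSupp hgc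
  -- Mollifiers have time support in `[-1, 1]`, so `K` carries `g` and all its mollifications.
  set K : Set (ST d) := Icc (a - 1) (b + 1) ×ˢ univ with hK
  have hKm : MeasurableSet K := (isCompact_slab _ _).measurableSet
  have hKf : volume K ≠ ⊤ := (isCompact_slab _ _).measure_lt_top.ne
  have hε' : 0 < ε / (volume.real K + 1) := by positivity
  filter_upwards [eventually_norm_conv_moll_sub_le hg hgc hε'] with k hk
  have hsupp : ∀ z ∉ K, conv (moll k) g z - g z = 0 := by
    intro z hz
    have hk1 : 1 / ((k : ℝ) + 1) ≤ 1 := by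
      rw [div_le_one (by positivity)]; linarith [(Nat.cast_nonneg k : (0 : ℝ) ≤ k)]
    have hz' : z.1 ∉ Icc (a - 1) (b + 1) := fun h => hz ⟨h, mem_univ _⟩
    rw [((timeSupp_moll k).conv hab).mono (a' := a - 1) (b' := b + 1) (by linarith) (by linarith)
      z hz', hab.mono (a' := a - 1) (b' := b + 1) (by linarith) (by linarith) z hz', sub_zero]
  have h1 : ∫ z, ‖conv (moll k) g z - g z‖ ≤ ε := by
    calc ∫ z, ‖conv (moll k) g z - g z‖
        ≤ ∫ z, K.indicator (fun _ => ε / (volume.real K + 1)) z := by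
          refine integral_mono ((integrable_conv_moll k hgi).sub hgi).norm
            ((integrable_indicator_iff hKm).2 (integrableOn_const hKf)) fun z => ?_
          by_cases hz : z ∈ K
          · simpa [hz] using hk z
          · simp [hz, hsupp z hz]
      _ = volume.real K * (ε / (volume.real K + 1)) := by
          rw [integral_indicator hKm, setIntegral_const, smul_eq_mul]
      _ ≤ ε := by
          have : 0 ≤ volume.real K := measureReal_nonneg
          rw [← mul_div_assoc, div_le_iff₀ (by positivity)]
          nlinarith
  have h2 : ∫ z, ‖conv (moll k) (fun w => f w - g w) z‖ ≤ ε :=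
    (integral_norm_conv_moll_le k (hf.sub hgi)).trans hfg
  have hadd : ∀ z, conv (moll k) (fun w => f w - g w) z = conv (moll k) f z - conv (moll k) g z := by
    intro z
    simp only [conv, smul_sub]
    exact integral_sub (conv_integrand_integrable (isC1_moll k).cont (hasCompactSupport_moll k) hf z)
      (conv_integrand_integrable (isC1_moll k).cont (hasCompactSupport_moll k) hgi z)
  have i1 := (integrable_conv_moll k (hf.sub hgi)).norm
  have i2 := ((integrable_conv_moll k hgi).sub hgi).norm
  have i3 := (hf.sub hgi).norm
  calc ∫ z, ‖conv (moll k) f z - f z‖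
      ≤ ∫ z, (‖conv (moll k) (fun w => f w - g w) z‖ + ‖conv (moll k) g z - g z‖ + ‖f z - g z‖) := by
        refine integral_mono ((integrable_conv_moll k hf).sub hf).norm ((i1.add i2).add i3)
          fun z => ?_
        have : conv (moll k) f z - f z = conv (moll k) (fun w => f w - g w) z +
          (conv (moll k) g z - g z) - (f z - g z) := by rw [hadd]; abel
        simp only [this]
        exact (norm_sub_le _ _).trans (add_le_add_left (norm_add_le _ _) _)
    _ = (∫ z, ‖conv (moll k) (fun w => f w - g w) z‖) + (∫ z, ‖conv (moll k) g z - g z‖)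
        + ∫ z, ‖f z - g z‖ := by
        exact (integral_add (i1.add i2) i3).trans (congrArg (· + _) (integral_add i1 i2))
    _ ≤ 3 * ε := by linarith

omit [NormedSpace ℝ E] in
/-- Convergence in `L¹` implies convergence almost everywhere along a subsequence. -/
theorem exists_subseq_tendsto_ae {f : ℕ → ST d → E} {g : ST d → E}
    (hf : ∀ k, Integrable (f k)) (hg : Integrable g)
    (h : Tendsto (fun k => ∫ z, ‖f k z - g z‖) atTop (𝓝 0)) :
    ∃ ns : ℕ → ℕ, StrictMono ns ∧ ∀ᵐ z, Tendsto (fun k => f (ns k) z) atTop (𝓝 (g z)) := by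
  refine TendstoInMeasure.exists_seq_tendsto_ae (tendstoInMeasure_of_tendsto_eLpNorm one_ne_zero
    (fun k => (hf k).aestronglyMeasurable) hg.aestronglyMeasurable ?_)
  have : ∀ k, eLpNorm (f k - g) 1 volume = ENNReal.ofReal (∫ z, ‖f k z - g z‖) := by
    intro k
    rw [eLpNorm_one_eq_lintegral_enorm, ← ofReal_integral_norm_eq_lintegral_enorm ((hf k).sub hg)]
    rfl
  simp only [this]
  simpa [Function.comp_def] using (ENNReal.continuous_ofReal.tendsto 0).comp h

end

/-! ### Weak equations tested with `C¹` functions. -/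

section

variable {d : ℕ} {E : Type*} [NormedAddCommGroup E] [NormedSpace ℝ E]

/-- The compact slab of times in `[a, b]`. -/
def slab (d : ℕ) (a b : ℝ) : Set (ST d) := Icc a b ×ˢ univ

theorem measurableSet_slab (a b : ℝ) : MeasurableSet (slab d a b) :=
  (isCompact_slab a b).measurableSet

theorem measurableSet_cyl (T : ℝ) : MeasurableSet (cyl d T) :=
  measurableSet_Ico.prod MeasurableSet.univ

theorem mem_slab {a b : ℝ} {z : ST d} : z ∈ slab d a b ↔ z.1 ∈ Icc a b := by
  simp [slab]

theorem slab_subset_cyl {a b T : ℝ} (ha : 0 < a) (hb : b < T) : slab d a b ⊆ cyl d T :=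
  prod_mono (fun _ h => ⟨ha.le.trans h.1, h.2.trans_lt hb⟩) subset_rfl

theorem slab_subset_openCyl {a b T : ℝ} (ha : 0 < a) (hb : b < T) : slab d a b ⊆ openCyl d T :=
  prod_mono (fun _ h => ⟨ha.trans_le h.1, h.2.trans_lt hb⟩) subset_rfl

theorem volume_cyl_lt_top (T : ℝ) : volume (cyl d T) < ⊤ :=
  (measure_mono (prod_mono Ico_subset_Icc_self subset_rfl)).trans_lt
    (isCompact_slab 0 T).measure_lt_top

omit [NormedSpace ℝ E] in
theorem _root_.MeasureTheory.LocallyIntegrableOn.integrableOn_slab {f : ST d → E} {T a b : ℝ}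
    (hf : LocallyIntegrableOn f (openCyl d T)) (ha : 0 < a) (hb : b < T) :
    IntegrableOn f (slab d a b) :=
  hf.integrableOn_compact_subset (slab_subset_openCyl ha hb) (isCompact_slab a b)

/-- A factor supported inside the slab lets a merely locally integrable `B` be replaced by its
truncation, which is integrable on all of space-time. -/
theorem TimeSupp.cyl_indicator_smul {a b a' b' T : ℝ} {f : ST d → ℝ} (hf : TimeSupp a b f)
    (ha : 0 < a') (hb : b' < T) (haa : a' ≤ a) (hbb : b ≤ b') (B : ST d → E) :
    (cyl d T).indicator (fun z => f z • B z) = fun z => f z • (slab d a' b').indicator B z := by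
  ext z
  by_cases hz : z ∈ slab d a' b'
  · rw [indicator_of_mem hz, indicator_of_mem (slab_subset_cyl ha hb hz)]
  · rw [indicator_of_notMem hz, smul_zero]
    have : f z = 0 := hf.mono haa hbb z fun h => hz (mem_slab.2 h)
    classical rw [indicator_apply, this, zero_smul, ite_self]

theorem TimeSupp.setIntegral_cyl_smul {a b a' b' T : ℝ} {f : ST d → ℝ} (hf : TimeSupp a b f)
    (ha : 0 < a') (hb : b' < T) (haa : a' ≤ a) (hbb : b ≤ b') (B : ST d → E) :
    ∫ z in cyl d T, f z • B z = ∫ z, f z • (slab d a' b').indicator B z := by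
  rw [← integral_indicator (measurableSet_cyl T), hf.cyl_indicator_smul ha hb haa hbb]

theorem TimeSupp.integrableOn_cyl_smul {a b T : ℝ} {f : ST d → ℝ} (hf : TimeSupp a b f)
    (hfc : Continuous f) (ha : 0 < a) (hb : b < T) {B : ST d → E}
    (hB : IntegrableOn B (slab d a b)) : IntegrableOn (fun z => f z • B z) (cyl d T) := by
  rw [← integrable_indicator_iff (measurableSet_cyl T),
    hf.cyl_indicator_smul ha hb le_rfl le_rfl]
  obtain ⟨C, hC⟩ := hf.hasCompactSupport.exists_bound_of_continuous hfc
  exact ((integrable_indicator_iff (measurableSet_slab a b)).2 hB).bdd_smul C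
    hfc.aestronglyMeasurable (ae_of_all _ hC)

theorem isTest_moll_sub {T a b : ℝ} {k : ℕ} (z : ST d) (ha : 0 < a - 1 / ((k : ℝ) + 1))
    (hb : b + 1 / ((k : ℝ) + 1) < T) (hz : z.1 ∈ Icc a b) :
    IsTest T (fun w => moll k (w - z)) := by
  refine ⟨?_, a - 1 / ((k : ℝ) + 1), b + 1 / ((k : ℝ) + 1), ha, hb, fun w hw =>
    timeSupp_moll k _ fun h => hw ?_⟩
  · obtain ⟨y, rfl⟩ := isOpenQuotientMap_cover.surjective z
    have : (fun x : ℝ × (Fin d → ℝ) => moll k ((x.1, toTorus x.2) - cover y : ST d)) =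
        fun x => moll k (cover (x - y)) := by
      ext x
      rfl
    rw [this]
    exact (contDiff_moll_cover k).comp (contDiff_id.sub contDiff_const)
  · simp only [Prod.fst_sub, mem_Icc] at h hz ⊢
    exact ⟨by linarith, by linarith⟩

theorem dd_comp_sub (f : ST d → E) (i : Option (Fin d)) (z w : ST d) :
    dd i (fun x => f (x - z)) w = dd i f (w - z) := by
  simp only [dd, sub_add_eq_add_sub]

theorem eventually_one_div_lt {ε : ℝ} (hε : 0 < ε) : ∀ᶠ k : ℕ in atTop, 1 / ((k : ℝ) + 1) < ε :=
  (tendsto_one_div_add_atTop_nhds_zero_nat (𝕜 := ℝ)).eventually (gt_mem_nhds hε)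

/-- Both sides are the derivative of `moll k * Ψ`, which may fall on either factor. -/
theorem dd_conv_moll_of_isC1 {a b : ℝ} {Ψ : ST d → ℝ} (hΨ : IsC1 Ψ) (hs : TimeSupp a b Ψ)
    (k : ℕ) (i : Option (Fin d)) : conv (dd i (moll k)) Ψ = conv (moll k) (dd i Ψ) := by
  have hΨi : Integrable Ψ := hΨ.cont.integrable_of_hasCompactSupport hs.hasCompactSupport
  rw [← ((isC1_moll k).conv (hasCompactSupport_moll k) hΨi).2, conv_comm,
    (hΨ.conv hs.hasCompactSupport (integrable_moll k)).2, conv_comm]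

/-- A weak equation in divergence form extends from test functions to `C¹` functions that are
compactly supported in time. -/
theorem sum_integral_dd_mul_eq_zero {T : ℝ} {B : Option (Fin d) → ST d → ℝ}
    (hB : ∀ i a b, 0 < a → b < T → IntegrableOn (B i) (slab d a b))
    (h : ∀ φ, IsTest T φ → ∑ i, ∫ z in cyl d T, dd i φ z • B i z = 0)
    {a b : ℝ} (ha : 0 < a) (hb : b < T) {Ψ : ST d → ℝ} (hΨ : IsC1 Ψ) (hs : TimeSupp a b Ψ) :
    ∑ i, ∫ z in cyl d T, dd i Ψ z • B i z = 0 := by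
  -- The larger slab `[a', b']` leaves room inside `(0, T)` for the support to spread under
  -- mollification.
  set a' := a / 2 with ha'
  set b' := (b + T) / 2 with hb'
  set B' : Option (Fin d) → ST d → ℝ := fun i => (slab d a' b').indicator (B i) with hB'
  have ha'0 : 0 < a' := by positivity
  have hb'T : b' < T := by rw [hb']; linarith
  have hB'i : ∀ i, Integrable (B' i) := fun i =>
    (integrable_indicator_iff (measurableSet_slab _ _)).2 (hB i a' b' ha'0 hb'T)
  have hΨi : Integrable Ψ := hΨ.cont.integrable_of_hasCompactSupport hs.hasCompactSupport
  -- By Fubini, testing with the mollified `Ψ` is the superposition, with weights `Ψ z`, of the weak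
  -- equations tested with the translates `moll k (· - z)`.
  have step : ∀ᶠ k : ℕ in atTop, ∑ i, ∫ w, conv (moll k) (dd i Ψ) w * B' i w = 0 := by
    filter_upwards [eventually_one_div_lt (ε := a / 2) (by positivity),
      eventually_one_div_lt (ε := (T - b) / 2) (by linarith)] with k hk1 hk2
    have hc : ∀ i, HasCompactSupport (dd i (moll k : ST d → ℝ)) := fun i =>
      ((timeSupp_moll k).dd i).hasCompactSupport
    have hint : ∀ i, Integrable (fun p : ST d × ST d =>
        Ψ p.1 * (dd i (moll k) (p.2 - p.1) * B' i p.2)) (volume.prod volume) := by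
      intro i
      obtain ⟨C, hC⟩ := (hc i).exists_bound_of_continuous ((isC1_moll k).cont_dd i)
      have h1 := (hΨi.mul_prod (hB'i i)).bdd_smul C
        (φ := fun p : ST d × ST d => dd i (moll k) (p.2 - p.1))
        (((isC1_moll k).cont_dd i).comp (by fun_prop)).aestronglyMeasurable
        (ae_of_all _ fun p => hC _)
      refine h1.congr (ae_of_all _ fun p => ?_)
      simp only [Pi.smul_apply', smul_eq_mul]
      ring
    have h0 : ∀ z, ∑ i, ∫ w, Ψ z * (dd i (moll k) (w - z) * B' i w) = 0 := by
      intro z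
      by_cases hz : z.1 ∈ Icc a b
      · have ht := isTest_moll_sub (T := T) (k := k) z (by linarith) (by linarith) hz
        have h1 := h _ ht
        have h2 : ∀ i, ∫ w in cyl d T, dd i (fun w => moll k (w - z)) w • B i w =
            ∫ w, dd i (moll k) (w - z) * B' i w := by
          intro i
          have hts : TimeSupp a' b' (fun w => moll k (w - z)) := fun w hw =>
            timeSupp_moll k _ fun h => hw (by
              simp only [Prod.fst_sub, mem_Icc] at h hz ⊢
              exact ⟨by linarith, by linarith⟩)
          rw [(hts.dd i).setIntegral_cyl_smul ha'0 hb'T le_rfl le_rfl]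
          simp only [dd_comp_sub, smul_eq_mul, hB']
        simp only [h2] at h1
        simp only [integral_const_mul]
        rw [← Finset.mul_sum, h1, mul_zero]
      · simp [hs z hz]
    have h1 : ∑ i, ∫ z, ∫ w, Ψ z * (dd i (moll k) (w - z) * B' i w) = 0 := by
      rw [← integral_finsetSum _ fun i _ => (hint i).integral_prod_left]
      simp [h0]
    rw [← h1]
    refine Finset.sum_congr rfl fun i _ => ?_
    rw [integral_integral_swap (hint i)]
    refine integral_congr_ae (ae_of_all _ fun w => ?_)
    simp only
    rw [← dd_conv_moll_of_isC1 hΨ hs, conv, ← integral_mul_const]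
    refine integral_congr_ae (ae_of_all _ fun z => ?_)
    simp only [smul_eq_mul]
    ring
  have lim : Tendsto (fun k : ℕ => ∑ i, ∫ w, conv (moll k) (dd i Ψ) w * B' i w) atTop
      (𝓝 (∑ i, ∫ w, dd i Ψ w * B' i w)) := by
    refine tendsto_finsetSum _ fun i _ => ?_
    have hci := (hs.dd i).hasCompactSupport
    obtain ⟨C, hC⟩ := hci.exists_bound_of_continuous (hΨ.cont_dd i)
    have hdi : Integrable (dd i Ψ) := (hΨ.cont_dd i).integrable_of_hasCompactSupport hci
    refine tendsto_integral_of_dominated_convergence (fun w => C * |B' i w|)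
      (fun k => ((continuous_conv (isC1_moll k).cont (hasCompactSupport_moll k)
        hdi).aestronglyMeasurable.mul (hB'i i).aestronglyMeasurable))
      ((hB'i i).norm.const_mul C) (fun k => ae_of_all _ fun w => ?_) (ae_of_all _ fun w => ?_)
    · rw [norm_mul]
      exact mul_le_mul_of_nonneg_right (norm_conv_moll_le k (ae_of_all _ hC) w) (norm_nonneg _)
    · refine Tendsto.mul_const _ ?_
      rw [tendsto_iff_norm_sub_tendsto_zero, Metric.tendsto_atTop']
      intro ε hε
      obtain ⟨N, hN⟩ := eventually_atTop.1
        (eventually_norm_conv_moll_sub_le (hΨ.cont_dd i) hci (half_pos hε))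
      refine ⟨N, fun k hk => ?_⟩
      rw [Real.dist_0_eq_abs, abs_of_nonneg (norm_nonneg _)]
      linarith [hN k hk.le w]
  have e : ∀ i, ∫ z in cyl d T, dd i Ψ z • B i z = ∫ w, dd i Ψ w * B' i w := fun i =>
    (hs.dd i).setIntegral_cyl_smul ha'0 hb'T (by rw [ha']; linarith) (by rw [hb']; linarith) _
  simp only [e]
  exact tendsto_nhds_unique lim (tendsto_const_nhds.congr' (step.mono fun k hk => hk.symm))

end

/-! ### Nonlinear test functions `φ(t) g(v)` for `v` in `W^{1,∞}`. -/

section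

variable {d n m : ℕ}

/-- `v` is continuous on the closed cylinder and `w` is its bounded weak space-time gradient. -/
structure HasWeakGrad (T : ℝ) (v : ST d → State n) (w : Option (Fin d) → ST d → State n) :
    Prop where
  cont : ContinuousOn v (closedCyl d T)
  memLp : ∀ i, MemLp (w i) ⊤ (volume.restrict (cyl d T))
  weak : ∀ i φ, IsTest T φ →
    ∫ z in cyl d T, dd i φ z • v z = - ∫ z in cyl d T, φ z • w i z

theorem exists_ae_norm_le_of_memLp_top {α E : Type*} [MeasurableSpace α] [NormedAddCommGroup E]
    {μ : Measure α} {f : α → E} (hf : MemLp f ⊤ μ) : ∃ C, ∀ᵐ z ∂μ, ‖f z‖ ≤ C := by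
  refine ⟨(eLpNormEssSup f μ).toReal, ?_⟩
  have h : eLpNormEssSup f μ ≠ ⊤ := by simpa using hf.eLpNorm_ne_top
  filter_upwards [enorm_ae_le_eLpNormEssSup f μ] with z hz
  rw [← toReal_enorm]
  exact ENNReal.toReal_mono h hz

theorem cyl_subset_closedCyl (T : ℝ) : cyl d T ⊆ closedCyl d T :=
  prod_mono Ico_subset_Icc_self subset_rfl

theorem HasWeakGrad.exists_bound {T : ℝ} {v : ST d → State n} {w : Option (Fin d) → ST d → State n}
    (h : HasWeakGrad T v w) : ∃ M, (∀ z ∈ closedCyl d T, ‖v z‖ ≤ M) ∧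
      ∀ i, ∀ᵐ z ∂(volume.restrict (cyl d T)), ‖w i z‖ ≤ M := by
  obtain ⟨M, hM⟩ := (isCompact_slab (d := d) 0 T).exists_bound_of_continuousOn h.cont
  choose W hW using fun i => exists_ae_norm_le_of_memLp_top (h.memLp i)
  refine ⟨|M| + ∑ i, |W i|, fun z hz => ?_, fun i => ?_⟩
  · have h1 : 0 ≤ ∑ i, |W i| := Finset.sum_nonneg fun _ _ => abs_nonneg _
    linarith [hM z hz, le_abs_self M]
  · filter_upwards [hW i] with z hz
    have h1 : |W i| ≤ ∑ i, |W i| :=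
      Finset.single_le_sum (fun i _ => abs_nonneg (W i)) (Finset.mem_univ i)
    linarith [le_abs_self (W i), abs_nonneg M]

theorem moll_sub_comm (k : ℕ) (z w : ST d) : moll k (z - w) = moll k (w - z) := by
  rw [← neg_sub w z, moll_neg]

theorem dd_moll_neg (k : ℕ) (i : Option (Fin d)) (z : ST d) :
    dd i (moll k) (-z) = - dd i (moll k) z := by
  have h1 : HasDerivAt (fun s : ℝ => moll k (-z + dir i s)) (- dd i (moll k) z) 0 := by
    have h2 := (isC1_moll k).hasDerivAt i z (-0)
    have h3 := h2.scomp (0 : ℝ) (hasDerivAt_neg 0)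
    simp only [neg_zero, dir_zero, add_zero, neg_smul, one_smul, Function.comp_def] at h3
    have e : (fun s : ℝ => moll k (-z + dir i s)) = fun s => moll k (z + dir i (-s)) := by
      ext s
      rw [← moll_neg]
      congr 1
      have : dir i s + dir i (-s) = (0 : ST d) := by rw [← dir_add]; simp [dir_zero]
      rw [neg_add, neg_neg, eq_neg_of_add_eq_zero_left this, neg_neg]
    rw [e]
    exact h3
  exact h1.deriv

/-- Mollification commutes with weak derivatives, away from the initial and final times. -/
theorem HasWeakGrad.dd_conv_moll {T : ℝ} {v : ST d → State n} {w : Option (Fin d) → ST d → State n}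
    (h : HasWeakGrad T v w) {a b : ℝ} {k : ℕ} (ha : 0 < a - 1 / ((k : ℝ) + 1))
    (hb : b + 1 / ((k : ℝ) + 1) < T) {z : ST d} (hz : z.1 ∈ Icc a b) (i : Option (Fin d)) :
    conv (dd i (moll k)) ((cyl d T).indicator v) z =
      conv (moll k) ((cyl d T).indicator (w i)) z := by
  have h1 := h.weak i _ (isTest_moll_sub (T := T) (k := k) z ha hb hz)
  have e : ∀ (ρ : ST d → ℝ) (f : ST d → State n), conv ρ ((cyl d T).indicator f) z =
      ∫ x in cyl d T, ρ (z - x) • f x := by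
    intro ρ f
    rw [conv, ← integral_indicator (measurableSet_cyl T)]
    refine integral_congr_ae (ae_of_all _ fun x => ?_)
    by_cases hx : x ∈ cyl d T <;> simp [hx]
  rw [e, e]
  simp only [moll_sub_comm k z]
  rw [← neg_eq_iff_eq_neg] at h1
  rw [← h1, ← integral_neg]
  refine integral_congr_ae (ae_of_all _ fun x => ?_)
  simp only [dd_comp_sub]
  -- The derivative of an even function is odd; this sign cancels the one in the definition of the
  -- weak derivative.
  rw [← neg_sub x z, dd_moll_neg, neg_smul]

theorem HasWeakGrad.integrable_indicator {T : ℝ} {v : ST d → State n}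
    {w : Option (Fin d) → ST d → State n} (h : HasWeakGrad T v w) :
    Integrable ((cyl d T).indicator v) ∧ ∀ i, Integrable ((cyl d T).indicator (w i)) := by
  have : IsFiniteMeasure (volume.restrict (cyl d T)) :=
    ⟨by rw [Measure.restrict_apply_univ]; exact volume_cyl_lt_top T⟩
  refine ⟨(integrable_indicator_iff (measurableSet_cyl T)).2 ?_, fun i =>
    (integrable_indicator_iff (measurableSet_cyl T)).2 ((h.memLp i).integrable le_top)⟩
  exact (h.cont.integrableOn_compact (isCompact_slab 0 T)).mono_set (cyl_subset_closedCyl T)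

/-- Testing a weak equation in divergence form with `φ(t) g(v)`, for `v` in `W^{1,∞}`. -/
theorem HasWeakGrad.integral_mul_eq_zero {T : ℝ} {v : ST d → State n}
    {w : Option (Fin d) → ST d → State n} (h : HasWeakGrad T v w)
    {B : Option (Fin d) → ST d → ℝ}
    (hB : ∀ i a b, 0 < a → b < T → IntegrableOn (B i) (slab d a b))
    (hBeq : ∀ φ, IsTest T φ → ∑ i, ∫ z in cyl d T, dd i φ z • B i z = 0)
    {g : State n → ℝ} (hg : ContDiff ℝ 1 g) {φ : ℝ → ℝ} (hφ : ContDiff ℝ 1 φ)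
    {a b : ℝ} (ha : 0 < a) (hb : b < T) (hφs : ∀ t ∉ Icc a b, φ t = 0) :
    (∀ i, IntegrableOn (fun z => (dd i (fun z => φ z.1) z * g (v z)
      + φ z.1 * fderiv ℝ g (v z) (w i z)) * B i z) (cyl d T)) ∧
    ∑ i, ∫ z in cyl d T, (dd i (fun z => φ z.1) z * g (v z)
      + φ z.1 * fderiv ℝ g (v z) (w i z)) * B i z = 0 := by
  obtain ⟨hvi, hwi⟩ := h.integrable_indicator
  set v' := (cyl d T).indicator v with hv'
  set w' : Option (Fin d) → ST d → State n := fun i => (cyl d T).indicator (w i) with hw'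
  set B' : Option (Fin d) → ST d → ℝ := fun i => (slab d a b).indicator (B i) with hB'
  have hB'i : ∀ i, Integrable (B' i) := fun i =>
    (integrable_indicator_iff (measurableSet_slab _ _)).2 (hB i a b ha hb)
  set Φ : ST d → ℝ := fun z => φ z.1 with hΦ
  have hΦs : TimeSupp a b Φ := fun z hz => hφs _ hz
  have hΦc : IsC1 Φ := (isC1_time hφ).1
  have hVc : ∀ k, IsC1 (conv (moll k) v') := fun k =>
    ((isC1_moll k).conv (hasCompactSupport_moll k) hvi).1
  set Ψ : ℕ → ST d → ℝ := fun k z => Φ z * g (conv (moll k) v' z) with hΨ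
  have hΨc : ∀ k, IsC1 (Ψ k) := fun k => (hΦc.mul ((hVc k).comp_contDiff hg).1).1
  have hΨs : ∀ k, TimeSupp a b (Ψ k) := fun k z hz => by simp [hΨ, hΦs z hz]
  -- On the support of `φ` the mollifier stays inside `(0, T)`, so the gradient of the mollified `v`
  -- is the mollified weak gradient; elsewhere the term containing it has the factor `φ = 0`.
  have hΨd : ∀ᶠ k : ℕ in atTop, ∀ i z, dd i (Ψ k) z = dd i Φ z * g (conv (moll k) v' z) +
      Φ z * fderiv ℝ g (conv (moll k) v' z) (conv (moll k) (w' i) z) := by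
    filter_upwards [eventually_one_div_lt ha, eventually_one_div_lt (sub_pos.2 hb)] with k h1 h2 i z
    simp only [hΨ]
    rw [(hΦc.mul ((hVc k).comp_contDiff hg).1).2, ((hVc k).comp_contDiff hg).2,
      ((isC1_moll k).conv (hasCompactSupport_moll k) hvi).2]
    by_cases hz : z.1 ∈ Icc a b
    · have e : conv (dd i (moll k)) v' z = conv (moll k) (w' i) z :=
        h.dd_conv_moll (by linarith) (by linarith) hz i
      simp only [e]
    · simp [hΦs z hz]
  -- Summing the errors of `v` and of all its derivatives provides one subsequence along which
  -- everything converges almost everywhere.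
  obtain ⟨ns, hns, hlim⟩ := exists_subseq_tendsto_ae
    (f := fun k z => ‖conv (moll k) v' z - v' z‖ + ∑ i, ‖conv (moll k) (w' i) z - w' i z‖)
    (g := fun _ : ST d => (0 : ℝ))
    (fun k => ((integrable_conv_moll k hvi).sub hvi).norm.add
      (integrable_finsetSum _ fun i _ => ((integrable_conv_moll k (hwi i)).sub (hwi i)).norm))
    (integrable_zero _ _ _) (by
      have h1 := (tendsto_integral_norm_conv_moll_sub hvi).add
        (tendsto_finsetSum Finset.univ fun i _ => tendsto_integral_norm_conv_moll_sub (hwi i))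
      simp only [Finset.sum_const_zero, add_zero] at h1
      refine h1.congr fun k => ?_
      refine (congrArg ((∫ z, ‖conv (moll k) v' z - v' z‖) + ·) (integral_finsetSum _ fun i _ =>
        ((integrable_conv_moll k (hwi i)).sub (hwi i)).norm).symm).trans ?_
      refine (integral_add ((integrable_conv_moll k hvi).sub hvi).norm
        (integrable_finsetSum _ fun i _ =>
          ((integrable_conv_moll k (hwi i)).sub (hwi i)).norm)).symm.trans ?_
      refine integral_congr_ae (ae_of_all _ fun z => ?_)
      simp only [sub_zero]
      rw [Real.norm_of_nonneg (by positivity)]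
      rfl)
  have hlimv : ∀ᵐ z, Tendsto (fun k => conv (moll (ns k)) v' z) atTop (𝓝 (v' z)) := by
    filter_upwards [hlim] with z hz
    rw [tendsto_iff_norm_sub_tendsto_zero]
    refine squeeze_zero (fun _ => norm_nonneg _) (fun k => ?_) hz
    exact le_add_of_nonneg_right (Finset.sum_nonneg fun _ _ => norm_nonneg _)
  have hlimw : ∀ᵐ z, ∀ i, Tendsto (fun k => conv (moll (ns k)) (w' i) z) atTop (𝓝 (w' i z)) := by
    filter_upwards [hlim] with z hz i
    rw [tendsto_iff_norm_sub_tendsto_zero]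
    refine squeeze_zero (fun _ => norm_nonneg _) (fun k => ?_) hz
    exact (Finset.single_le_sum (f := fun i => ‖conv (moll (ns k)) (w' i) z - w' i z‖)
      (fun _ _ => norm_nonneg _) (Finset.mem_univ i)).trans
      (le_add_of_nonneg_left (norm_nonneg _))
  obtain ⟨M, hMv, hMw⟩ := h.exists_bound
  have hM'v : ∀ z, ‖v' z‖ ≤ |M| := fun z => by
    by_cases hz : z ∈ cyl d T
    · simpa [hv', hz] using (hMv z (cyl_subset_closedCyl T hz)).trans (le_abs_self M)
    · simp [hv', hz]
  have hM'w : ∀ i, ∀ᵐ z, ‖w' i z‖ ≤ |M| := fun i => by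
    have := (ae_restrict_iff' (measurableSet_cyl T)).1 (hMw i)
    filter_upwards [this] with z hz
    by_cases hzc : z ∈ cyl d T
    · simpa [hw', hzc] using (hz hzc).trans (le_abs_self M)
    · simp [hw', hzc]
  -- Mollification preserves the bound `|M|`, so `g` and its derivative are only evaluated on one
  -- compact ball; this supplies the dominating function.
  obtain ⟨Cg, hCg⟩ := (isCompact_closedBall (0 : State n) |M|).exists_bound_of_continuousOn
    hg.continuous.continuousOn
  obtain ⟨CD, hCD⟩ := (isCompact_closedBall (0 : State n) |M|).exists_bound_of_continuousOn
    (hg.continuous_fderiv (by norm_num)).continuousOn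
  obtain ⟨C0, hC0⟩ := hΦs.hasCompactSupport.exists_bound_of_continuous hΦc.cont
  have main : ∀ i, Integrable (fun z => (dd i Φ z * g (v' z) +
      Φ z * fderiv ℝ g (v' z) (w' i z)) * B' i z) ∧
      Tendsto (fun k => ∫ z, dd i (Ψ (ns k)) z * B' i z) atTop
        (𝓝 (∫ z, (dd i Φ z * g (v' z) + Φ z * fderiv ℝ g (v' z) (w' i z)) * B' i z)) := by
    intro i
    obtain ⟨C1, hC1⟩ := (hΦs.dd i).hasCompactSupport.exists_bound_of_continuous (hΦc.cont_dd i)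
    have hmeas : ∀ k, AEStronglyMeasurable (fun z => dd i (Ψ (ns k)) z * B' i z) volume := fun k =>
      ((hΨc _).cont_dd i).aestronglyMeasurable.mul (hB'i i).aestronglyMeasurable
    have hbint : Integrable (fun z => (C1 * Cg + C0 * (CD * |M|)) * ‖B' i z‖) :=
      (hB'i i).norm.const_mul _
    have hbd : ∀ᶠ k in atTop, ∀ᵐ z, ‖dd i (Ψ (ns k)) z * B' i z‖ ≤
        (C1 * Cg + C0 * (CD * |M|)) * ‖B' i z‖ := by
      filter_upwards [hns.tendsto_atTop.eventually hΨd] with k hk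
      refine ae_of_all _ fun z => ?_
      rw [norm_mul, hk]
      refine mul_le_mul_of_nonneg_right ?_ (norm_nonneg _)
      have hb1 : conv (moll (ns k)) v' z ∈ Metric.closedBall (0 : State n) |M| :=
        mem_closedBall_zero_iff.2 (norm_conv_moll_le _ (ae_of_all _ hM'v) z)
      have hb2 : ‖conv (moll (ns k)) (w' i) z‖ ≤ |M| := norm_conv_moll_le _ (hM'w i) z
      refine (norm_add_le _ _).trans (add_le_add ?_ ?_)
      · rw [norm_mul]
        exact mul_le_mul (hC1 z) (hCg _ hb1) (norm_nonneg _) ((norm_nonneg _).trans (hC1 z))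
      · rw [norm_mul]
        refine mul_le_mul (hC0 z) ?_ (norm_nonneg _) ((norm_nonneg _).trans (hC0 z))
        refine (ContinuousLinearMap.le_opNorm _ _).trans ?_
        exact mul_le_mul (hCD _ hb1) hb2 (norm_nonneg _) ((norm_nonneg _).trans (hCD _ hb1))
    have hpt : ∀ᵐ z, Tendsto (fun k => dd i (Ψ (ns k)) z * B' i z) atTop
        (𝓝 ((dd i Φ z * g (v' z) + Φ z * fderiv ℝ g (v' z) (w' i z)) * B' i z)) := by
      filter_upwards [hlimv, hlimw] with z hz1 hz2
      refine Tendsto.mul_const _ ?_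
      have t1 := (hg.continuous.tendsto (v' z)).comp hz1
      have t2 : Tendsto (fun k => fderiv ℝ g (conv (moll (ns k)) v' z)) atTop
        (𝓝 (fderiv ℝ g (v' z))) := ((hg.continuous_fderiv (by norm_num)).tendsto (v' z)).comp hz1
      have t2' := ((isBoundedBilinearMap_apply (𝕜 := ℝ) (E := State n) (F := ℝ)).continuous.tendsto
        (fderiv ℝ g (v' z), w' i z)).comp (t2.prodMk_nhds (hz2 i))
      have t3 := (t1.const_mul (dd i Φ z)).add (t2'.const_mul (Φ z))
      refine t3.congr' ?_
      filter_upwards [hns.tendsto_atTop.eventually hΨd] with k hk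
      rw [hk]; rfl
    refine ⟨?_, tendsto_integral_filter_of_dominated_convergence _
      (Eventually.of_forall hmeas) hbd hbint hpt⟩
    refine hbint.mono' (aestronglyMeasurable_of_tendsto_ae _ hmeas hpt) ?_
    obtain ⟨N, hN⟩ := eventually_atTop.1 hbd
    have hN' : ∀ᵐ z, ∀ k ≥ N, ‖dd i (Ψ (ns k)) z * B' i z‖ ≤
        (C1 * Cg + C0 * (CD * |M|)) * ‖B' i z‖ :=
      ae_all_iff.2 fun k => by
        by_cases hk : k ≥ N
        · filter_upwards [hN k hk] with z hz _ using hz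
        · exact ae_of_all _ fun z h => absurd h hk
    filter_upwards [hpt, hN'] with z h1 h2
    exact le_of_tendsto h1.norm (eventually_atTop.2 ⟨N, h2⟩)
  have e : ∀ i, (cyl d T).indicator (fun z => (dd i Φ z * g (v z)
      + φ z.1 * fderiv ℝ g (v z) (w i z)) * B i z) = fun z => (dd i Φ z * g (v' z) +
      Φ z * fderiv ℝ g (v' z) (w' i z)) * B' i z := by
    intro i
    ext z
    by_cases hz : z ∈ cyl d T
    · by_cases hs : z ∈ slab d a b
      · simp [hz, hs, hv', hw', hB', hΦ]
      · have hs' : z.1 ∉ Icc a b := fun h => hs (mem_slab.2 h)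
        simp [hz, hs, hB', (hΦs.dd i) z hs', hφs _ hs']
    · have hs : z ∉ slab d a b := fun h => hz (slab_subset_cyl ha hb h)
      simp [hz, hs, hB']
  refine ⟨fun i => ?_, ?_⟩
  · rw [← integrable_indicator_iff (measurableSet_cyl T), e]
    exact (main i).1
  · have h1 : ∀ k, ∑ i, ∫ z, dd i (Ψ (ns k)) z * B' i z = 0 := by
      intro k
      rw [← sum_integral_dd_mul_eq_zero hB hBeq ha hb (hΨc (ns k)) (hΨs (ns k))]
      exact Finset.sum_congr rfl fun i _ =>
        (((hΨs (ns k)).dd i).setIntegral_cyl_smul ha hb le_rfl le_rfl _).symm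
    have h2 := tendsto_finsetSum Finset.univ fun i _ => (main i).2
    simp only [h1] at h2
    have h3 := tendsto_nhds_unique h2 tendsto_const_nhds
    rw [← h3]
    refine Finset.sum_congr rfl fun i _ => ?_
    rw [← integral_indicator (measurableSet_cyl T), e]

end

/-! ### Global inversion of `A`, symmetry and convexity. -/

section

variable {n : ℕ}

local notation "⟪" x ", " y "⟫" => inner ℝ x y

/-- A proper injective local diffeomorphism of `ℝⁿ` is a global diffeomorphism. -/
theorem exists_contDiff_inverse {A : State n → State n} (hA : ContDiff ℝ 2 A)
    (hinj : Function.Injective A) (hns : ∀ u, Function.Bijective (fderiv ℝ A u))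
    (htop : Tendsto (fun u => ‖A u‖) (Bornology.cobounded (State n)) atTop) :
    ∃ S : State n → State n, ContDiff ℝ 2 S ∧ (∀ u, S (A u) = u) ∧ ∀ U, A (S U) = U := by
  let A' : State n → (State n ≃L[ℝ] State n) := fun u =>
    ContinuousLinearEquiv.ofBijective (fderiv ℝ A u)
      (LinearMap.ker_eq_bot.2 (hns u).1) (LinearMap.range_eq_top.2 (hns u).2)
  have hA' : ∀ u, (A' u : State n →L[ℝ] State n) = fderiv ℝ A u := fun u => by
    ext x; rfl
  have hopen : IsOpenMap A := isOpenMap_of_hasStrictFDerivAt_equiv (f' := A') fun u => by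
    rw [hA']; exact hA.contDiffAt.hasStrictFDerivAt (by norm_num)
  have hprop : IsProperMap A := isProperMap_iff_tendsto_cocompact.2 ⟨hA.continuous, by
    rw [← Metric.cobounded_eq_cocompact]
    exact tendsto_norm_atTop_iff_cobounded.1 htop⟩
  -- The range is open by the inverse function theorem and closed by properness, and `ℝⁿ` is
  -- connected.
  have hsurj : Function.Surjective A := by
    rw [← range_eq_univ]
    exact IsClopen.eq_univ ⟨hprop.isClosedMap.isClosed_range, hopen.isOpen_range⟩ (range_nonempty A)
  let e : State n ≃ₜ State n :=
    (Equiv.ofBijective A ⟨hinj, hsurj⟩).toHomeomorphOfContinuousOpen hA.continuous hopen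
  refine ⟨e.symm, e.contDiff_symm (f₀' := A') (fun u => ?_) hA, e.symm_apply_apply,
    e.apply_symm_apply⟩
  rw [hA']
  exact (hA.differentiable (by norm_num) u).hasFDerivAt

/-- Differentiating `∇η = G·∇A` once more identifies the form `∇²η - G·∇²A` of (H3) with `DGᵀDA`. -/
theorem fderiv_fderiv_of_multiplier {A : State n → State n} (hA : ContDiff ℝ 2 A)
    {G : State n → State n} (hG : ContDiff ℝ 1 G) {η : State n → ℝ}
    (h : ∀ u ξ, fderiv ℝ η u ξ = ⟪G u, fderiv ℝ A u ξ⟫) (hη : ContDiff ℝ 2 η) (u ξ ζ : State n) :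
    fderiv ℝ (fderiv ℝ η) u ξ ζ =
      ⟪G u, fderiv ℝ (fderiv ℝ A) u ξ ζ⟫ + ⟪fderiv ℝ G u ξ, fderiv ℝ A u ζ⟫ := by
  have dη : DifferentiableAt ℝ (fderiv ℝ η) u :=
    (hη.fderiv_right (m := 1) (by norm_num)).differentiable (by norm_num) u
  have dA : DifferentiableAt ℝ (fderiv ℝ A) u :=
    (hA.fderiv_right (m := 1) (by norm_num)).differentiable (by norm_num) u
  have dG : DifferentiableAt ℝ G u := hG.differentiable (by norm_num) u
  have h1 : HasFDerivAt (fun x => fderiv ℝ η x ζ)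
      ((ContinuousLinearMap.apply ℝ ℝ ζ).comp (fderiv ℝ (fderiv ℝ η) u)) u :=
    (ContinuousLinearMap.apply ℝ ℝ ζ).hasFDerivAt.comp u dη.hasFDerivAt
  have h2 : HasFDerivAt (fun x => fderiv ℝ A x ζ)
      ((ContinuousLinearMap.apply ℝ (State n) ζ).comp (fderiv ℝ (fderiv ℝ A) u)) u :=
    (ContinuousLinearMap.apply ℝ (State n) ζ).hasFDerivAt.comp u dA.hasFDerivAt
  have h3 := dG.hasFDerivAt.inner ℝ h2
  have e : (fun x => fderiv ℝ η x ζ) = fun x => ⟪G x, fderiv ℝ A x ζ⟫ := funext fun x => h x ζ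
  rw [e] at h1
  have := congrArg (fun L => L ξ) (h1.unique h3)
  simpa [fderivInnerCLM_apply] using this

/-- This form is a difference of symmetric second derivatives. Only `C¹` is asked of `η`, so that
the lemma also covers `(F_α, q_α)`: the identity `∇η = G·∇A` itself upgrades `η` to `C²`. -/
theorem inner_fderiv_symm {A : State n → State n} (hA : ContDiff ℝ 2 A)
    {G : State n → State n} (hG : ContDiff ℝ 1 G) {η : State n → ℝ} (hη : ContDiff ℝ 1 η)
    (h : ∀ u ξ, fderiv ℝ η u ξ = ⟪G u, fderiv ℝ A u ξ⟫) (u ξ ζ : State n) :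
    ⟪fderiv ℝ G u ξ, fderiv ℝ A u ζ⟫ = ⟪fderiv ℝ G u ζ, fderiv ℝ A u ξ⟫ := by
  have hη2 : ContDiff ℝ 2 η := by
    rw [show (2 : ℕ∞ω) = 1 + 1 by norm_num, contDiff_succ_iff_fderiv]
    refine ⟨hη.differentiable (by norm_num), by simp, ?_⟩
    have : fderiv ℝ η = fun u => (innerSL ℝ (G u)).comp (fderiv ℝ A u) := by
      ext u ξ; simp [h]
    rw [this]
    exact ((innerSL ℝ).contDiff.comp hG).clm_comp (hA.fderiv_right (by norm_num))
  have s1 := (hη2.contDiffAt (x := u)).isSymmSndFDerivAt (by simp) ξ ζ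
  have s2 := (hA.contDiffAt (x := u)).isSymmSndFDerivAt (by simp) ξ ζ
  rw [fderiv_fderiv_of_multiplier hA hG h hη2, fderiv_fderiv_of_multiplier hA hG h hη2, s2] at s1
  linarith

/-- Strong convexity on balls of a function whose gradient has a positive definite derivative. -/
theorem exists_strong_convexity {f : State n → ℝ} {g : State n → State n} (hf : Differentiable ℝ f)
    (hg : ContDiff ℝ 1 g) (hfg : ∀ U ξ, fderiv ℝ f U ξ = ⟪g U, ξ⟫)
    (hpos : ∀ U ξ, ξ ≠ 0 → 0 < ⟪fderiv ℝ g U ξ, ξ⟫) (R : ℝ) :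
    ∃ c > 0, ∀ U ∈ Metric.closedBall (0 : State n) R, ∀ V ∈ Metric.closedBall (0 : State n) R,
      c * ‖U - V‖ ^ 2 ≤ f U - f V - ⟪g V, U - V⟫ := by
  -- The constant is a positive lower bound of the quadratic form on the compact product of the ball
  -- and the unit sphere; homogeneity extends it to all `ξ`.
  obtain ⟨c, hc, h⟩ := ((isCompact_closedBall (0 : State n) R).prod
    (isCompact_sphere (0 : State n) 1)).exists_forall_le' (a := 0)
    (f := fun x : State n × State n => ⟪fderiv ℝ g x.1 x.2, x.2⟫)
    (by
      have : Continuous fun x : State n × State n => fderiv ℝ g x.1 x.2 :=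
        (hg.contDiff_fderiv_apply (m := 0) (by norm_num)).continuous
      exact (this.inner continuous_snd).continuousOn)
    (fun x hx => hpos _ _ (by
      have := mem_sphere_zero_iff_norm.1 hx.2
      intro h0; rw [h0] at this; simp at this))
  have hq : ∀ U ∈ Metric.closedBall (0 : State n) R, ∀ ξ, c * ‖ξ‖ ^ 2 ≤ ⟪fderiv ℝ g U ξ, ξ⟫ := by
    intro U hU ξ
    by_cases hξ : ξ = 0
    · simp [hξ]
    have hn : 0 < ‖ξ‖ := norm_pos_iff.2 hξ
    have := h (U, ‖ξ‖⁻¹ • ξ) ⟨hU, by simp [norm_smul, hn.ne']⟩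
    simp only [map_smul, real_inner_smul_left, real_inner_smul_right] at this
    rw [← mul_assoc, ← mul_inv, inv_mul_eq_div, le_div_iff₀ (by positivity)] at this
    rwa [pow_two]
  refine ⟨c / 2, by positivity, fun U hU V hV => ?_⟩
  set ξ := U - V with hξ
  have hγ : ∀ s : ℝ, HasDerivAt (fun s : ℝ => V + s • ξ) ξ s := fun s => by
    simpa using ((hasDerivAt_id s).smul_const ξ).const_add V
  have hmem : ∀ s ∈ Icc (0 : ℝ) 1, V + s • ξ ∈ Metric.closedBall (0 : State n) R := fun s hs =>
    (convex_closedBall _ _).add_smul_sub_mem hV hU hs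
  have hk : ∀ s : ℝ, HasDerivAt (fun s : ℝ => ⟪g (V + s • ξ), ξ⟫ - c * s * ‖ξ‖ ^ 2)
      (⟪fderiv ℝ g (V + s • ξ) ξ, ξ⟫ - c * ‖ξ‖ ^ 2) s := by
    intro s
    have h1 := ((hg.differentiable (by norm_num) (V + s • ξ)).hasFDerivAt.comp_hasDerivAt s
      (hγ s)).inner ℝ (hasDerivAt_const s ξ)
    have h2 := ((hasDerivAt_id s).const_mul c).mul_const (‖ξ‖ ^ 2)
    exact (h1.sub h2).congr_deriv (by simp)
  have hm : ∀ s : ℝ, HasDerivAt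
      (fun s : ℝ => f (V + s • ξ) - s * ⟪g V, ξ⟫ - c / 2 * s ^ 2 * ‖ξ‖ ^ 2)
      (⟪g (V + s • ξ), ξ⟫ - ⟪g V, ξ⟫ - c * s * ‖ξ‖ ^ 2) s := by
    intro s
    have h1 := (hf (V + s • ξ)).hasFDerivAt.comp_hasDerivAt s (hγ s)
    rw [hfg] at h1
    have h2 := (hasDerivAt_id s).mul_const ⟪g V, ξ⟫
    have h3 := (((hasDerivAt_id s).pow 2).const_mul (c / 2)).mul_const (‖ξ‖ ^ 2)
    refine ((h1.sub h2).sub h3).congr_deriv ?_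
    simp only [id, pow_one, Nat.reduceSub, Nat.cast_ofNat]
    ring
  -- The lower bound on the derivative of `g` is integrated twice along the segment from `V` to `U`,
  -- each time as a monotonicity statement.
  have kmono : MonotoneOn (fun s : ℝ => ⟪g (V + s • ξ), ξ⟫ - c * s * ‖ξ‖ ^ 2) (Icc 0 1) := by
    refine monotoneOn_of_deriv_nonneg (convex_Icc 0 1)
      (fun s _ => (hk s).continuousAt.continuousWithinAt)
      (fun s _ => (hk s).differentiableAt.differentiableWithinAt) fun s hs => ?_
    rw [(hk s).deriv, sub_nonneg]
    exact hq _ (hmem s (interior_subset hs)) ξ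
  have mmono : MonotoneOn
      (fun s : ℝ => f (V + s • ξ) - s * ⟪g V, ξ⟫ - c / 2 * s ^ 2 * ‖ξ‖ ^ 2) (Icc 0 1) := by
    refine monotoneOn_of_deriv_nonneg (convex_Icc 0 1)
      (fun s _ => (hm s).continuousAt.continuousWithinAt)
      (fun s _ => (hm s).differentiableAt.differentiableWithinAt) fun s hs => ?_
    rw [(hm s).deriv]
    have hs' := interior_subset hs
    have := kmono (left_mem_Icc.2 zero_le_one) hs' hs'.1
    simp only [zero_smul, add_zero, mul_zero, zero_mul, sub_zero] at this
    linarith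
  have := mmono (left_mem_Icc.2 zero_le_one) (right_mem_Icc.2 zero_le_one) zero_le_one
  simp only [zero_smul, add_zero, zero_mul, sub_zero, one_smul, one_mul, one_pow, mul_one,
    ne_eq, OfNat.ofNat_ne_zero, not_false_eq_true, zero_pow, mul_zero] at this
  rw [hξ, add_sub_cancel, ← hξ] at this
  linarith

/-- The mean value inequality is used twice: on the ball it makes `DF` Lipschitz, and on the segment
it bounds the remainder. -/
theorem exists_quadratic_remainder {F : State n → State n} (hF : ContDiff ℝ 2 F) (R : ℝ) :
    ∃ L ≥ 0, ∀ U ∈ Metric.closedBall (0 : State n) R, ∀ V ∈ Metric.closedBall (0 : State n) R,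
      ‖F U - F V - fderiv ℝ F V (U - V)‖ ≤ L * ‖U - V‖ ^ 2 := by
  have hF1 : ContDiff ℝ 1 (fderiv ℝ F) := hF.fderiv_right (by norm_num)
  obtain ⟨L, hL⟩ := (isCompact_closedBall (0 : State n) R).exists_bound_of_continuousOn
    (hF1.continuous_fderiv (by norm_num)).continuousOn
  refine ⟨|L|, abs_nonneg _, fun U hU V hV => ?_⟩
  have hseg : segment ℝ V U ⊆ Metric.closedBall (0 : State n) R :=
    (convex_closedBall _ _).segment_subset hV hU
  have h := (convex_segment V U).norm_image_sub_le_of_norm_fderiv_le' (𝕜 := ℝ)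
    (φ := fderiv ℝ F V) (C := |L| * ‖U - V‖)
    (fun x _ => hF.differentiable (by norm_num) x) (fun x hx => ?_)
    (left_mem_segment ℝ V U) (right_mem_segment ℝ V U)
  · exact h.trans (by rw [pow_two, mul_assoc])
  · have h1 := (convex_closedBall (0 : State n) R).norm_image_sub_le_of_norm_fderiv_le (𝕜 := ℝ)
      (f := fderiv ℝ F) (C := |L|) (fun x _ => hF1.differentiable (by norm_num) x)
      (fun x hx => (hL x hx).trans (le_abs_self L)) hV (hseg hx)
    refine h1.trans (mul_le_mul_of_nonneg_left ?_ (abs_nonneg _))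
    exact norm_sub_le_of_mem_segment hx

/-- The relative entropy of the pair `(A, η)` with multiplier `G`. -/
noncomputable def relEnt (A : State n → State n) (η : State n → ℝ) (G : State n → State n)
    (u v : State n) : ℝ := η u - η v - ⟪G v, A u - A v⟫

end

/-! ### Upper and lower bounds for the relative entropy. -/

section

variable {n : ℕ}

local notation "⟪" x ", " y "⟫" => inner ℝ x y

theorem fderiv_comp_inverse {A S : State n → State n} (hA : ContDiff ℝ 2 A) (hS : ContDiff ℝ 2 S)
    (hAS : ∀ U, A (S U) = U) (U ξ : State n) : fderiv ℝ A (S U) (fderiv ℝ S U ξ) = ξ := by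
  have h1 := (hA.differentiable (by norm_num) (S U)).hasFDerivAt.comp U
    (hS.differentiable (by norm_num) U).hasFDerivAt
  have h2 : A ∘ S = id := funext hAS
  rw [h2] at h1
  simpa using congrArg (fun L => L ξ) (h1.unique (hasFDerivAt_id U))

theorem fderiv_comp_eq_apply {V : Type*} [NormedAddCommGroup V] [NormedSpace ℝ V]
    {f : State n → V} {S : State n → State n} (hf : Differentiable ℝ f) (hS : Differentiable ℝ S)
    (U ξ : State n) :
    fderiv ℝ (fun x => f (S x)) U ξ = fderiv ℝ f (S U) (fderiv ℝ S U ξ) :=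
  congrArg (fun L => L ξ) (fderiv_comp U (hf (S U)) (hS U))

/-- The relative entropy controls the quadratic remainder of a vector field `F = o(η)`, written in
the conserved variables `A(u)`. -/
theorem exists_norm_remainder_le_relEnt {A S F G : State n → State n} {η : State n → ℝ}
    (hA : ContDiff ℝ 2 A) (hS : ContDiff ℝ 2 S) (hSA : ∀ u, S (A u) = u) (hAS : ∀ U, A (S U) = U)
    (hF : ContDiff ℝ 2 F) (hη : ContDiff ℝ 2 η) (hG : ContDiff ℝ 1 G)
    (hgrad : ∀ u ξ, fderiv ℝ η u ξ = ⟪G u, fderiv ℝ A u ξ⟫)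
    (hpos : ∀ u ξ, ξ ≠ 0 →
      0 < fderiv ℝ (fderiv ℝ η) u ξ ξ - ⟪G u, fderiv ℝ (fderiv ℝ A) u ξ ξ⟫)
    (hη0 : ∀ u, 0 ≤ η u) (hηtop : Tendsto η (Bornology.cobounded (State n)) atTop)
    (hFo : F =o[Bornology.cobounded (State n)] η) (hAo : A =o[Bornology.cobounded (State n)] η)
    {K : Set (State n)} (hK : IsCompact K) :
    ∃ C ≥ 0, ∀ v ∈ K, ∀ u, 0 ≤ relEnt A η G u v ∧ (relEnt A η G u v = 0 → u = v) ∧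
      ‖F u - F v - fderiv ℝ F v (fderiv ℝ S (A v) (A u - A v))‖ ≤ C * relEnt A η G u v := by
  have hSd : Differentiable ℝ S := hS.differentiable (by norm_num)
  have hFS : ∀ U ξ, fderiv ℝ (fun U => F (S U)) U ξ = fderiv ℝ F (S U) (fderiv ℝ S U ξ) :=
    fderiv_comp_eq_apply (hF.differentiable (by norm_num)) hSd
  have hgS : ContDiff ℝ 1 fun U => G (S U) := hG.comp (hS.of_le (by norm_num))
  have hηS : Differentiable ℝ fun U => η (S U) := (hη.differentiable (by norm_num)).comp hSd
  have hFS2 : ContDiff ℝ 2 fun U => F (S U) := hF.comp hS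
  obtain ⟨M1, hM1⟩ := hK.exists_bound_of_continuousOn hG.continuous.continuousOn
  obtain ⟨M2, hM2⟩ := hK.exists_bound_of_continuousOn hA.continuous.continuousOn
  obtain ⟨M3, hM3⟩ := hK.exists_bound_of_continuousOn hF.continuous.continuousOn
  obtain ⟨M4, hM4⟩ := hK.exists_bound_of_continuousOn hη.continuous.continuousOn
  obtain ⟨M5, hM5⟩ := hK.exists_bound_of_continuousOn
    ((hFS2.continuous_fderiv (by norm_num)).comp hA.continuous).continuousOn
  obtain ⟨M6, hM6⟩ := hK.exists_bound_of_continuousOn (continuous_id (X := State n)).continuousOn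
  obtain ⟨M, hM0, h1M, h2M, h3M, h4M, h5M⟩ : ∃ M : ℝ, 0 ≤ M ∧ M1 ≤ M ∧ M2 ≤ M ∧ M3 ≤ M ∧
      M4 ≤ M ∧ M5 ≤ M := by
    refine ⟨|M1| + |M2| + |M3| + |M4| + |M5|, by positivity, ?_, ?_, ?_, ?_, ?_⟩ <;>
    linarith [le_abs_self M1, le_abs_self M2, le_abs_self M3, le_abs_self M4, le_abs_self M5,
      abs_nonneg M1, abs_nonneg M2, abs_nonneg M3, abs_nonneg M4, abs_nonneg M5]
  -- With this constant `M |A u| ≤ η u / 4`, and the threshold `4 (M + M²) + 1` for `η u` absorbs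
  -- all terms depending on `v` into another quarter. Hence `relEnt ≥ η u / 2 > 0` for large `u`.
  have hε : (0 : ℝ) < 1 / (4 * (M + 1)) := by positivity
  have hfar := ((hFo.def one_pos).and (hAo.def hε)).and
    (hηtop.eventually_ge_atTop (4 * (M + M * M) + 1))
  obtain ⟨r, -, hr⟩ := hasBasis_cobounded_norm.eventually_iff.1 hfar
  -- The ball of radius `max r M6` contains both `K` and the states not treated as large; `A` maps
  -- it into the ball of radius `R` where convexity is used.
  obtain ⟨R, hR⟩ := (isCompact_closedBall (0 : State n) (max r M6)).exists_bound_of_continuousOn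
    hA.continuous.continuousOn
  obtain ⟨c, hc, hconv⟩ := exists_strong_convexity hηS hgS
    (fun U ξ => by
      rw [fderiv_comp_eq_apply (hη.differentiable (by norm_num)) hSd]
      simp [hgrad, fderiv_comp_inverse hA hS hAS])
    -- With `ζ = DS(U) ξ ≠ 0` one has `DA ζ = ξ`, so the Hessian of `η ∘ S` at `ξ` is the form of
    -- (H3) at `ζ`.
    (fun U ξ hξ => by
      rw [fderiv_comp_eq_apply (hG.differentiable (by norm_num)) hSd]
      have e := fderiv_comp_inverse hA hS hAS U ξ
      have h0 : fderiv ℝ S U ξ ≠ 0 := fun h => hξ (by rw [← e, h, map_zero])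
      have := hpos (S U) _ h0
      rw [fderiv_fderiv_of_multiplier hA hG hgrad hη, add_sub_cancel_left, e] at this
      exact this) R
  obtain ⟨L, hL0, hL⟩ := exists_quadratic_remainder hFS2 R
  -- `L / c` serves bounded `u` (Taylor against strong convexity); `4` serves large `u`, where the
  -- remainder is at most `2 η u ≤ 4 relEnt`.
  refine ⟨L / c + 4, by positivity, fun v hv u => ?_⟩
  have ev : ∀ ξ, fderiv ℝ F v (fderiv ℝ S (A v) ξ) = fderiv ℝ (fun U => F (S U)) (A v) ξ :=
    fun ξ => by rw [hFS, hSA]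
  rw [ev]
  by_cases hu : r ≤ ‖u‖
  · obtain ⟨⟨hF1, hA1⟩, hη1⟩ := hr hu
    rw [one_mul, Real.norm_of_nonneg (hη0 u)] at hF1
    rw [Real.norm_of_nonneg (hη0 u)] at hA1
    have hMA : M * ‖A u‖ ≤ η u / 4 := by
      refine (mul_le_mul_of_nonneg_left hA1 hM0).trans ?_
      have : M * (1 / (4 * (M + 1))) ≤ 1 / 4 := by
        rw [mul_one_div, div_le_div_iff₀ (by positivity) (by norm_num)]
        linarith
      calc M * (1 / (4 * (M + 1)) * η u) = M * (1 / (4 * (M + 1))) * η u := by ring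
        _ ≤ 1 / 4 * η u := mul_le_mul_of_nonneg_right this (hη0 u)
        _ = η u / 4 := by ring
    have hGv := (hM1 v hv).trans h1M
    have hAv := (hM2 v hv).trans h2M
    have hFv := (hM3 v hv).trans h3M
    have hηv := (le_abs_self _).trans ((hM4 v hv).trans h4M)
    have hDv : ‖fderiv ℝ (fun U => F (S U)) (A v)‖ ≤ M := (hM5 v hv).trans h5M
    have hAsub : M * ‖A u - A v‖ ≤ η u / 4 + M * M := by
      have := mul_le_mul_of_nonneg_left ((norm_sub_le (A u) (A v)).trans
        (add_le_add_right hAv _)) hM0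
      linarith
    have hin : ⟪G v, A u - A v⟫ ≤ η u / 4 + M * M :=
      (real_inner_le_norm _ _).trans
        ((mul_le_mul_of_nonneg_right hGv (norm_nonneg _)).trans hAsub)
    have hH : η u / 2 ≤ relEnt A η G u v := by
      rw [relEnt]; linarith
    have hη2 : 1 ≤ η u := by nlinarith
    refine ⟨by linarith, fun h => by linarith, ?_⟩
    have hZ : ‖F u - F v - fderiv ℝ (fun U => F (S U)) (A v) (A u - A v)‖ ≤ 2 * η u := by
      have h1 := (ContinuousLinearMap.le_opNorm (fderiv ℝ (fun U => F (S U)) (A v)) (A u - A v)).trans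
        (mul_le_mul_of_nonneg_right hDv (norm_nonneg _))
      have h2 := norm_sub_le (F u - F v) (fderiv ℝ (fun U => F (S U)) (A v) (A u - A v))
      have h3 := norm_sub_le (F u) (F v)
      linarith
    have h5 : 0 ≤ L / c * relEnt A η G u v := mul_nonneg (by positivity) (by linarith)
    linarith
  · have hUm : A u ∈ Metric.closedBall (0 : State n) R := mem_closedBall_zero_iff.2
      (hR u (mem_closedBall_zero_iff.2 ((not_le.1 hu).le.trans (le_max_left _ _))))
    have hVm : A v ∈ Metric.closedBall (0 : State n) R := mem_closedBall_zero_iff.2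
      (hR v (mem_closedBall_zero_iff.2 ((hM6 v hv).trans (le_max_right _ _))))
    have hH : c * ‖A u - A v‖ ^ 2 ≤ relEnt A η G u v := by
      have := hconv _ hUm _ hVm
      simpa only [hSA, relEnt] using this
    have hZ := hL _ hUm _ hVm
    simp only [hSA] at hZ
    have h0 : 0 ≤ relEnt A η G u v := le_trans (by positivity) hH
    refine ⟨h0, fun h => ?_, ?_⟩
    · rw [h] at hH
      have h1 : ‖A u - A v‖ ^ 2 ≤ 0 := by
        by_contra h'
        exact absurd hH (not_le.2 (mul_pos hc (not_le.1 h')))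
      have h2 : A u - A v = 0 := by
        rw [← norm_eq_zero]
        exact pow_eq_zero_iff (two_ne_zero) |>.1 (le_antisymm h1 (by positivity))
      rw [← hSA u, ← hSA v, sub_eq_zero.1 h2]
    · have h1 : ‖A u - A v‖ ^ 2 ≤ relEnt A η G u v / c := by
        rw [le_div_iff₀ hc]; linarith
      calc _ ≤ L * ‖A u - A v‖ ^ 2 := hZ
        _ ≤ L * (relEnt A η G u v / c) := mul_le_mul_of_nonneg_left h1 hL0
        _ = L / c * relEnt A η G u v := by ring
        _ ≤ _ := by linarith

theorem continuous_relEnt {A G : State n → State n} {η : State n → ℝ} (hA : Continuous A)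
    (hη : Continuous η) (hG : Continuous G) :
    Continuous fun x : State n × State n => relEnt A η G x.1 x.2 :=
  ((hη.comp continuous_fst).sub (hη.comp continuous_snd)).sub ((hG.comp continuous_snd).inner
    ((hA.comp continuous_fst).sub (hA.comp continuous_snd)))

/-- Near the diagonal, continuity and compactness of `K` (tube lemma) keep `relEnt` below `ε`. Once
`|u - v| ≥ δ`, it is at most affine in `η u`, and both `|u|^p` and constants are controlled by `|u -
v|^p`. -/
theorem exists_relEnt_le_rpow {A G : State n → State n} {η : State n → ℝ} (hA : Continuous A)
    (hη : Continuous η) (hG : Continuous G) (hη0 : ∀ u, 0 ≤ η u)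
    (hAo : A =o[Bornology.cobounded (State n)] η) {p β : ℝ} (hp : 0 < p) (hβ : 0 ≤ β)
    (hgrowth : ∀ u, η u ≤ β * (‖u‖ ^ p + 1)) {K : Set (State n)} (hK : IsCompact K) {ε : ℝ}
    (hε : 0 < ε) : ∃ C ≥ 0, ∀ v ∈ K, ∀ u, relEnt A η G u v ≤ ε + C * ‖u - v‖ ^ p := by
  have hΦ : Continuous fun x : State n × State n => relEnt A η G (x.2 + x.1) x.2 :=
    (continuous_relEnt hA hη hG).comp ((continuous_snd.add continuous_fst).prodMk continuous_snd)
  obtain ⟨U, V, hU, -, h0U, hKV, hUV⟩ := generalized_tube_lemma (isCompact_singleton (x := (0 : State n)))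
    hK (hΦ.isOpen_preimage _ (isOpen_Iio (a := ε))) (by
      rintro ⟨x, v⟩ ⟨hx, hv⟩
      obtain rfl : x = 0 := hx
      simpa [relEnt] using hε)
  obtain ⟨δ, hδ, hball⟩ := Metric.isOpen_iff.1 hU 0 (h0U rfl)
  obtain ⟨M1, hM1⟩ := hK.exists_bound_of_continuousOn hG.continuousOn
  obtain ⟨M2, hM2⟩ := hK.exists_bound_of_continuousOn hA.continuousOn
  obtain ⟨M3, hM3⟩ := hK.exists_bound_of_continuousOn (continuous_id (X := State n)).continuousOn
  obtain ⟨r, -, hr⟩ := hasBasis_cobounded_norm.eventually_iff.1 (hAo.def one_pos)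
  obtain ⟨M4, hM4⟩ := (isCompact_closedBall (0 : State n) r).exists_bound_of_continuousOn
    hA.continuousOn
  have hAη : ∀ u, ‖A u‖ ≤ η u + |M4| := fun u => by
    by_cases hu : r ≤ ‖u‖
    · have := hr hu
      rw [one_mul, Real.norm_of_nonneg (hη0 u)] at this
      linarith [abs_nonneg M4]
    · linarith [hM4 u (mem_closedBall_zero_iff.2 (not_le.1 hu).le), le_abs_self M4, hη0 u]
  set a := 1 + |M1| with ha
  set b := |M1| * (|M4| + |M2|) with hb
  have hHη : ∀ v ∈ K, ∀ u, relEnt A η G u v ≤ a * η u + b := by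
    intro v hv u
    have h1 : -⟪G v, A u - A v⟫ ≤ |M1| * (η u + |M4| + |M2|) := by
      refine (neg_le_abs _).trans ((abs_real_inner_le_norm _ _).trans ?_)
      refine mul_le_mul ((hM1 v hv).trans (le_abs_self _)) ((norm_sub_le _ _).trans ?_)
        (norm_nonneg _) (abs_nonneg _)
      exact add_le_add (hAη u) ((hM2 v hv).trans (le_abs_self _))
    rw [relEnt, ha, hb]
    nlinarith [hη0 v]
  -- If `|u - v| ≥ δ` then `|u| ≤ |u - v| + |M3| ≤ q |u - v|`.
  set q := 1 + |M3| / δ with hq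
  have ha0 : 0 ≤ a := by positivity
  have hb0 : 0 ≤ b := by positivity
  refine ⟨a * β * (q ^ p + (1 / δ) ^ p) + b * (1 / δ) ^ p, by positivity, fun v hv u => ?_⟩
  by_cases huv : ‖u - v‖ < δ
  · have hmem : (u - v, v) ∈ U ×ˢ V := ⟨hball (by simpa using huv), hKV hv⟩
    have : relEnt A η G (v + (u - v)) v < ε := hUV hmem
    rw [add_sub_cancel] at this
    refine this.le.trans (le_add_of_nonneg_right ?_)
    positivity
  · have hδu := not_lt.1 huv
    have h1 : 1 ≤ (1 / δ) ^ p * ‖u - v‖ ^ p := by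
      rw [← Real.mul_rpow (by positivity) (norm_nonneg _)]
      refine Real.one_le_rpow ?_ hp.le
      rw [one_div, inv_mul_eq_div, le_div_iff₀ hδ]
      linarith
    have h2 : ‖u‖ ^ p ≤ q ^ p * ‖u - v‖ ^ p := by
      rw [← Real.mul_rpow (by positivity) (norm_nonneg _)]
      refine Real.rpow_le_rpow (norm_nonneg _) ?_ hp.le
      have h3 : ‖u‖ ≤ ‖u - v‖ + ‖v‖ := by simpa using norm_add_le (u - v) v
      have h4 : ‖v‖ ≤ |M3| := (hM3 v hv).trans (le_abs_self _)
      have h5 : |M3| ≤ |M3| / δ * ‖u - v‖ := by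
        rw [div_mul_eq_mul_div, le_div_iff₀ hδ]
        exact mul_le_mul_of_nonneg_left hδu (abs_nonneg _)
      rw [hq]
      linarith
    calc relEnt A η G u v ≤ a * η u + b * 1 := by rw [mul_one]; exact hHη v hv u
      _ ≤ a * (β * (q ^ p * ‖u - v‖ ^ p + (1 / δ) ^ p * ‖u - v‖ ^ p))
          + b * ((1 / δ) ^ p * ‖u - v‖ ^ p) := by
          refine add_le_add (mul_le_mul_of_nonneg_left ((hgrowth u).trans ?_) ha0)
            (mul_le_mul_of_nonneg_left h1 hb0)
          exact mul_le_mul_of_nonneg_left (add_le_add h2 h1) hβ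
      _ = (a * β * (q ^ p + (1 / δ) ^ p) + b * (1 / δ) ^ p) * ‖u - v‖ ^ p := by ring
      _ ≤ _ := by linarith

theorem tendsto_atTop_of_rpow_growth {η : State n → ℝ} {p β B : ℝ} (hp : 0 < p) (hβ : 0 < β)
    (h : ∀ u, β * (‖u‖ ^ p + 1) - B ≤ η u) : Tendsto η (Bornology.cobounded (State n)) atTop := by
  refine tendsto_atTop_mono h (tendsto_atTop_add_const_right _ _ (Tendsto.const_mul_atTop hβ
    (tendsto_atTop_add_const_right _ _ ?_)))
  exact (tendsto_rpow_atTop hp).comp tendsto_norm_cobounded_atTop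

/-- A bound on `A u` would bound `η u`. This is the properness needed to invert `A` globally. -/
theorem tendsto_norm_of_le_rpow {A : State n → State n} {η : State n → ℝ} {r C : ℝ} (hr : 0 < r)
    (hC : 0 < C) (h : ∀ u, η u ≤ C * (‖A u‖ ^ r + 1))
    (hη : Tendsto η (Bornology.cobounded (State n)) atTop) :
    Tendsto (fun u => ‖A u‖) (Bornology.cobounded (State n)) atTop := by
  rw [tendsto_atTop]
  intro M
  filter_upwards [hη.eventually_gt_atTop (C * (|M| ^ r + 1))] with u hu
  by_contra hM
  have h1 : ‖A u‖ ^ r ≤ |M| ^ r :=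
    Real.rpow_le_rpow (norm_nonneg _) ((not_le.1 hM).le.trans (le_abs_self M)) hr.le
  have h2 : C * (‖A u‖ ^ r + 1) ≤ C * (|M| ^ r + 1) :=
    mul_le_mul_of_nonneg_left (by linarith) hC.le
  linarith [h u]

end

/-! ### The relative entropy inequality. -/

section

variable {d n m : ℕ}

local notation "⟪" x ", " y "⟫" => inner ℝ x y

theorem IsTest.exists_timeSupp {T : ℝ} {φ : ST d → ℝ} (hφ : IsTest T φ) :
    ∃ a b, 0 < a ∧ b < T ∧ TimeSupp a b φ := by
  obtain ⟨a, b, ha, hb, h⟩ := hφ.supp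
  exact ⟨a, b, ha, hb, fun z hz => h z hz⟩

theorem HasWeakGrad.integral_inner_eq_zero {T : ℝ} {v : ST d → State n}
    {w : Option (Fin d) → ST d → State n} (h : HasWeakGrad T v w)
    {B : Option (Fin d) → ST d → State m}
    (hB : ∀ i a b, 0 < a → b < T → IntegrableOn (B i) (slab d a b))
    (hBeq : ∀ φ, IsTest T φ → ∑ i, ∫ z in cyl d T, dd i φ z • B i z = 0)
    {g : State n → State m} (hg : ContDiff ℝ 1 g) {φ : ℝ → ℝ} (hφ : ContDiff ℝ 1 φ)
    {a b : ℝ} (ha : 0 < a) (hb : b < T) (hφs : ∀ t ∉ Icc a b, φ t = 0) :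
    IntegrableOn (fun z => ∑ i, (dd i (fun z => φ z.1) z * ⟪g (v z), B i z⟫
      + φ z.1 * ⟪fderiv ℝ g (v z) (w i z), B i z⟫)) (cyl d T) ∧
    ∫ z in cyl d T, ∑ i, (dd i (fun z => φ z.1) z * ⟪g (v z), B i z⟫
      + φ z.1 * ⟪fderiv ℝ g (v z) (w i z), B i z⟫) = 0 := by
  have hgj : ∀ j, ContDiff ℝ 1 fun u => g u j := fun j =>
    (EuclideanSpace.proj (𝕜 := ℝ) j).contDiff.comp hg
  have hgj' : ∀ j u ξ, fderiv ℝ (fun u => g u j) u ξ = fderiv ℝ g u ξ j := fun j u ξ => by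
    have := (EuclideanSpace.proj (𝕜 := ℝ) (ι := Fin m) j).hasFDerivAt.comp u
      (hg.differentiable (by norm_num) u).hasFDerivAt
    rw [show (fun u => g u j) = (EuclideanSpace.proj (𝕜 := ℝ) (ι := Fin m) j) ∘ g from rfl,
      this.fderiv]
    rfl
  have key := fun j => h.integral_mul_eq_zero (B := fun i z => B i z j)
    (fun i a b ha hb => (EuclideanSpace.proj (𝕜 := ℝ) j).integrable_comp (hB i a b ha hb))
    (fun φ hφ => by
      obtain ⟨a, b, ha, hb, hs⟩ := hφ.exists_timeSupp
      have h1 := congrArg (EuclideanSpace.proj (𝕜 := ℝ) j) (hBeq φ hφ)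
      rw [map_sum, map_zero] at h1
      rw [← h1]
      refine Finset.sum_congr rfl fun i _ => ?_
      rw [← ContinuousLinearMap.integral_comp_comm _
        ((hs.dd i).integrableOn_cyl_smul (hφ.isC1.cont_dd i) ha hb (hB i a b ha hb))]
      rfl)
    (hgj j) hφ ha hb hφs
  have e : (fun z => ∑ i, (dd i (fun z => φ z.1) z * ⟪g (v z), B i z⟫
      + φ z.1 * ⟪fderiv ℝ g (v z) (w i z), B i z⟫)) = fun z => ∑ j, ∑ i,
      (dd i (fun z => φ z.1) z * g (v z) j
        + φ z.1 * fderiv ℝ (fun u => g u j) (v z) (w i z)) * B i z j := by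
    ext z
    rw [Finset.sum_comm]
    refine Finset.sum_congr rfl fun i _ => ?_
    simp only [PiLp.inner_apply, Finset.mul_sum, ← Finset.sum_add_distrib, hgj']
    refine Finset.sum_congr rfl fun j _ => ?_
    simp only [RCLike.inner_apply, conj_trivial]
    ring
  have hint : ∀ j, IntegrableOn (fun z => ∑ i, (dd i (fun z => φ z.1) z * g (v z) j
        + φ z.1 * fderiv ℝ (fun u => g u j) (v z) (w i z)) * B i z j) (cyl d T) := fun j =>
    integrable_finsetSum _ fun i _ => (key j).1 i
  rw [e]
  refine ⟨integrable_finsetSum _ fun j _ => hint j, ?_⟩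
  rw [integral_finsetSum _ fun j _ => hint j]
  refine Finset.sum_eq_zero fun j _ => ?_
  rw [integral_finsetSum _ fun i _ => (key j).1 i]
  exact (key j).2

/-- The chain rule for `g(v)`, tested with functions of time. -/
theorem HasWeakGrad.integral_chain_rule {T : ℝ} {v : ST d → State n}
    {w : Option (Fin d) → ST d → State n} (h : HasWeakGrad T v w)
    {g : State n → ℝ} (hg : ContDiff ℝ 1 g) {φ : ℝ → ℝ} (hφ : ContDiff ℝ 1 φ)
    {a b : ℝ} (ha : 0 < a) (hb : b < T) (hφs : ∀ t ∉ Icc a b, φ t = 0) (i : Option (Fin d)) :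
    IntegrableOn (fun z => dd i (fun z => φ z.1) z * g (v z)
      + φ z.1 * fderiv ℝ g (v z) (w i z)) (cyl d T) ∧
    ∫ z in cyl d T, (dd i (fun z => φ z.1) z * g (v z)
      + φ z.1 * fderiv ℝ g (v z) (w i z)) = 0 := by
  -- The constant field in direction `i` solves the weak equation trivially, and testing it with `φ
  -- g(v)` is the chain rule.
  have key := h.integral_mul_eq_zero (B := fun j _ => if j = i then 1 else 0)
    (fun j a b _ _ => integrableOn_const (isCompact_slab a b).measure_lt_top.ne)
    (fun φ hφ => by
      obtain ⟨a, b, ha, hb, hs⟩ := hφ.exists_timeSupp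
      refine Finset.sum_eq_zero fun j _ => ?_
      simp only [smul_eq_mul]
      rw [integral_mul_const, setIntegral_eq_integral_of_forall_compl_eq_zero fun z hz =>
        hs.dd j z fun h => hz (slab_subset_cyl ha hb (mem_slab.2 h)),
        integral_dd_eq_zero hφ.isC1 hs.hasCompactSupport, zero_mul])
    hg hφ ha hb hφs
  refine ⟨by simpa using key.1 i, ?_⟩
  have := key.2
  rw [Finset.sum_eq_single i (fun j _ hj => by simp [hj]) (by simp)] at this
  simpa using this

/-- The space-time flux `(A(u), F(u))`. -/
def flux (A : State n → State n) (F : Fin d → State n → State n) (u : ST d → State n) :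
    Option (Fin d) → ST d → State n
  | none => fun z => A (u z)
  | some α => fun z => F α (u z)

theorem IsWeakSolution.integrableOn_flux {T : ℝ} {A : State n → State n}
    {F : Fin d → State n → State n} {u : ST d → State n} (hu : IsWeakSolution T A F u)
    (i : Option (Fin d)) (a b : ℝ) (ha : 0 < a) (hb : b < T) :
    IntegrableOn (flux A F u i) (slab d a b) := by
  cases i with
  | none => exact hu.locInt_A.integrableOn_slab ha hb
  | some α => exact (hu.locInt_F α).integrableOn_slab ha hb

theorem IsWeakSolution.sum_integral_flux {T : ℝ} {A : State n → State n}
    {F : Fin d → State n → State n} {u : ST d → State n} (hu : IsWeakSolution T A F u)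
    (φ : ST d → ℝ) (hφ : IsTest T φ) :
    ∑ i, ∫ z in cyl d T, dd i φ z • flux A F u i z = 0 := by
  obtain ⟨a, b, ha, hb, hs⟩ := hφ.exists_timeSupp
  rw [← integral_finsetSum _ fun i _ => (hs.dd i).integrableOn_cyl_smul (hφ.isC1.cont_dd i) ha hb
    (hu.integrableOn_flux i a b ha hb), ← hu.eqn φ hφ]
  simp only [Fintype.sum_option, dd_none, dd_some, flux]

theorem IsStrongSolution.exists_hasWeakGrad {T : ℝ} {A : State n → State n}
    {F : Fin d → State n → State n} {v : ST d → State n} (hv : IsStrongSolution T A F v) :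
    ∃ w, HasWeakGrad T v w ∧ ∀ᵐ z ∂(volume.restrict (cyl d T)),
      fderiv ℝ A (v z) (w none z) + ∑ α, fderiv ℝ (F α) (v z) (w (some α) z) = 0 := by
  obtain ⟨wt, wx, h1, h2, h3, h4⟩ := hv.eqn
  refine ⟨fun i => i.elim wt wx, ⟨hv.cont, fun i => ?_, fun i φ hφ => ?_⟩, h4⟩
  · cases i with
    | none => exact h1
    | some α => exact (h3 α).1
  · cases i with
    | none => rw [dd_none]; exact h2 φ hφ
    | some α => rw [dd_some]; exact (h3 α).2 φ hφ

theorem isTest_time {T : ℝ} {φ : ℝ → ℝ} (hφ : ContDiff ℝ ∞ φ) {a b : ℝ} (ha : 0 < a) (hb : b < T)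
    (hφs : ∀ t ∉ Icc a b, φ t = 0) : IsTest T (fun z : ST d => φ z.1) :=
  ⟨hφ.comp contDiff_fst, a, b, ha, hb, fun _ hz => hφs _ hz⟩

theorem integrableOn_relEnt {T : ℝ} {A : State n → State n} {η : State n → ℝ}
    {G : State n → State n} (hA : Continuous A) (hη : Continuous η) (hG : Continuous G)
    {u v : ST d → State n} (hAu : LocallyIntegrableOn (fun z => A (u z)) (openCyl d T))
    (hηu : LocallyIntegrableOn (fun z => η (u z)) (openCyl d T))
    (hv : ContinuousOn v (closedCyl d T)) {a b : ℝ} (ha : 0 < a) (hb : b < T) :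
    IntegrableOn (fun z => relEnt A η G (u z) (v z)) (slab d a b) := by
  have hK : IsCompact (slab d a b) := isCompact_slab a b
  have hvs : ContinuousOn v (slab d a b) :=
    hv.mono ((slab_subset_cyl ha hb).trans (cyl_subset_closedCyl T))
  have hGv : ContinuousOn (fun z => G (v z)) (slab d a b) := hG.comp_continuousOn hvs
  have i1 := (hηu.integrableOn_slab ha hb).sub ((hη.comp_continuousOn hvs).integrableOn_compact hK)
  have i2 := (hAu.integrableOn_slab ha hb).sub ((hA.comp_continuousOn hvs).integrableOn_compact hK)
  obtain ⟨M, hM⟩ := hK.exists_bound_of_continuousOn hGv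
  refine i1.sub ((i2.norm.const_mul M).mono'
    ((hGv.aestronglyMeasurable (measurableSet_slab a b)).inner i2.aestronglyMeasurable) ?_)
  filter_upwards [ae_restrict_mem (measurableSet_slab a b)] with z hz
  exact (norm_inner_le_norm _ _).trans (mul_le_mul_of_nonneg_right (hM z hz) (norm_nonneg _))

/-- The weak form of the relative entropy inequality, with the remainder bounded by the relative
entropy. -/
theorem integral_relEnt_nonneg {T : ℝ} {A : State n → State n}
    {F : Fin d → State n → State n} {η : State n → ℝ} {q : Fin d → State n → ℝ}
    {G : State n → State n} (hA : ContDiff ℝ 2 A) (hF : ∀ α, ContDiff ℝ 2 (F α))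
    (hpair : IsEntropyPair A F η q G) {u v : ST d → State n}
    (hu : IsEntropyWeakSolution T A F η q u) {w : Option (Fin d) → ST d → State n}
    (hv : HasWeakGrad T v w)
    (hveq : ∀ᵐ z ∂(volume.restrict (cyl d T)),
      fderiv ℝ A (v z) (w none z) + ∑ α, fderiv ℝ (F α) (v z) (w (some α) z) = 0)
    {S : State n → State n} (hSA : ∀ v ξ, fderiv ℝ A v (fderiv ℝ S (A v) ξ) = ξ)
    {C : Fin d → ℝ} (hC0 : ∀ α, 0 ≤ C α)
    (hC : ∀ α, ∀ z ∈ closedCyl d T, ∀ u, ‖F α u - F α (v z) -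
      fderiv ℝ (F α) (v z) (fderiv ℝ S (A (v z)) (A u - A (v z)))‖ ≤ C α * relEnt A η G u (v z)) :
    ∃ Λ ≥ 0, ∀ φ : ℝ → ℝ, ContDiff ℝ ∞ φ → (∀ t, 0 ≤ φ t) → ∀ a b, 0 < a → b < T →
      (∀ t ∉ Icc a b, φ t = 0) →
      0 ≤ ∫ z in cyl d T, (deriv φ z.1 + Λ * φ z.1) * relEnt A η G (u z) (v z) := by
  have hA1 : ContDiff ℝ 1 A := hA.of_le (by norm_num)
  have hF1 : ∀ α, ContDiff ℝ 1 (F α) := fun α => (hF α).of_le (by norm_num)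
  have hη1 : ContDiff ℝ 1 η := hpair.smooth_η.of_le (by norm_num)
  obtain ⟨M, -, hMw⟩ := hv.exists_bound
  obtain ⟨D, hD⟩ := (isCompact_slab (d := d) 0 T).exists_bound_of_continuousOn
    ((hpair.smooth_G.continuous_fderiv (by norm_num)).comp_continuousOn hv.cont)
  -- Each summand multiplies the bounds for `DG(v)`, for the weak gradient of `v` and for the
  -- remainder of `F α`.
  refine ⟨∑ α, |D| * |M| * C α, Finset.sum_nonneg fun α _ => by
    have := hC0 α
    positivity, fun φ hφ hφ0 a b ha hb hφs => ?_⟩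
  set Λ := ∑ α, |D| * |M| * C α with hΛ
  have hφ1 : ContDiff ℝ 1 φ := hφ.of_le (by exact_mod_cast le_top)
  obtain ⟨-, hΦ0, hΦα⟩ := isC1_time (d := d) hφ1
  set R : ST d → ℝ := fun z => ⟪fderiv ℝ G (v z) (w none z), A (u z) - A (v z)⟫ +
    ∑ α, ⟪fderiv ℝ G (v z) (w (some α) z), F α (u z) - F α (v z)⟫ with hR
  have hRle : ∀ᵐ z ∂(volume.restrict (cyl d T)), -(Λ * relEnt A η G (u z) (v z)) ≤ R z := by
    filter_upwards [hveq, ae_all_iff.2 hMw, ae_restrict_mem (measurableSet_cyl T)] with z h1 h2 hz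
    have hzc := cyl_subset_closedCyl T hz
    set ζ := fderiv ℝ S (A (v z)) (A (u z) - A (v z)) with hζ
    -- Write `A(u) - A(v) = DA(v) ζ`. Symmetry moves the time derivative under `DA(v)`, the strong
    -- equation replaces it by the space derivatives under `DF_α(v)`, and symmetry for `F_α` moves
    -- them back.
    have e1 : ⟪fderiv ℝ G (v z) (w none z), A (u z) - A (v z)⟫ =
        - ∑ α, ⟪fderiv ℝ G (v z) (w (some α) z), fderiv ℝ (F α) (v z) ζ⟫ := by
      rw [← hSA (v z) (A (u z) - A (v z)), ← hζ,
        inner_fderiv_symm hA hpair.smooth_G hη1 hpair.grad_η, eq_neg_of_add_eq_zero_left h1,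
        inner_neg_right, inner_sum]
      congr 1
      refine Finset.sum_congr rfl fun α _ => ?_
      exact inner_fderiv_symm (hF α) hpair.smooth_G (hpair.smooth_q α) (hpair.grad_q α) _ _ _
    have e2 : R z = ∑ α, ⟪fderiv ℝ G (v z) (w (some α) z), F α (u z) - F α (v z) -
        fderiv ℝ (F α) (v z) ζ⟫ := by
      simp only [hR, e1, inner_sub_right _ _ (fderiv ℝ (F _) (v z) ζ), Finset.sum_sub_distrib]
      ring
    rw [e2, hΛ, Finset.sum_mul, ← Finset.sum_neg_distrib]
    refine Finset.sum_le_sum fun α _ => neg_le_of_abs_le ?_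
    refine (abs_real_inner_le_norm _ _).trans ?_
    have h3 : ‖fderiv ℝ G (v z) (w (some α) z)‖ ≤ |D| * |M| :=
      (ContinuousLinearMap.le_opNorm _ _).trans (mul_le_mul ((hD z hzc).trans (le_abs_self D))
        ((h2 _).trans (le_abs_self M)) (norm_nonneg _) (abs_nonneg _))
    rw [mul_assoc]
    exact mul_le_mul h3 (hC α z hzc (u z)) (norm_nonneg _) (by positivity)
  have hf0 : ContDiff ℝ 1 fun x => η x - ⟪G x, A x⟫ := hη1.sub (hpair.smooth_G.inner ℝ hA1)
  have hfα : ∀ α, ContDiff ℝ 1 fun x => q α x - ⟪G x, F α x⟫ := fun α =>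
    (hpair.smooth_q α).sub (hpair.smooth_G.inner ℝ (hF1 α))
  -- The multiplier relation cancels every term except the one in which `G` is differentiated.
  have hderiv : ∀ {Q : State n → ℝ} {P : State n → State n}, ContDiff ℝ 1 Q → ContDiff ℝ 1 P →
      (∀ x ξ, fderiv ℝ Q x ξ = ⟪G x, fderiv ℝ P x ξ⟫) → ∀ x ξ,
      fderiv ℝ (fun x => Q x - ⟪G x, P x⟫) x ξ = -⟪fderiv ℝ G x ξ, P x⟫ := by
    intro Q P hQ hP hQP x ξ
    have h1 := (hQ.differentiable (by norm_num) x).hasFDerivAt.sub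
      ((hpair.smooth_G.differentiable (by norm_num) x).hasFDerivAt.inner ℝ
        (hP.differentiable (by norm_num) x).hasFDerivAt)
    have h2 : fderiv ℝ (fun x => Q x - ⟪G x, P x⟫) x = _ := h1.fderiv
    rw [h2]
    simp [fderivInnerCLM_apply, hQP]
  obtain ⟨i0, z0⟩ := hv.integral_chain_rule hf0 hφ1 ha hb hφs none
  have hα := fun α => hv.integral_chain_rule (hfα α) hφ1 ha hb hφs (some α)
  obtain ⟨iF, zF⟩ := hv.integral_inner_eq_zero hu.integrableOn_flux hu.sum_integral_flux
    hpair.smooth_G hφ1 ha hb hφs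
  have hent := hu.entropy _ (isTest_time hφ ha hb hφs) fun z => hφ0 _
  have hΦs : TimeSupp a b (fun z : ST d => φ z.1) := fun z hz => hφs _ hz
  have iη : IntegrableOn (fun z => dt (fun z : ST d => φ z.1) z * η (u z) +
      ∑ α, dx α (fun z : ST d => φ z.1) z * q α (u z)) (cyl d T) := by
    simp only [← dd_some, hΦα, zero_mul, Finset.sum_const_zero, add_zero]
    rw [← dd_none]
    exact (hΦs.dd none).integrableOn_cyl_smul ((isC1_time hφ1).1.cont_dd none) ha hb
      (hu.locInt_η.integrableOn_slab ha hb)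
  have iα : IntegrableOn (fun z => ∑ α, (dd (some α) (fun z : ST d => φ z.1) z *
      (q α (v z) - ⟪G (v z), F α (v z)⟫) + φ z.1 *
      fderiv ℝ (fun x => q α x - ⟪G x, F α x⟫) (v z) (w (some α) z))) (cyl d T) :=
    integrable_finsetSum _ fun α _ => (hα α).1
  have zα : ∫ z in cyl d T, ∑ α, (dd (some α) (fun z : ST d => φ z.1) z *
      (q α (v z) - ⟪G (v z), F α (v z)⟫) + φ z.1 *
      fderiv ℝ (fun x => q α x - ⟪G x, F α x⟫) (v z) (w (some α) z)) = 0 := by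
    rw [integral_finsetSum _ fun α _ => (hα α).1]
    exact Finset.sum_eq_zero fun α _ => (hα α).2
  have iH : IntegrableOn (fun z => (deriv φ z.1 + Λ * φ z.1) * relEnt A η G (u z) (v z))
      (cyl d T) := by
    have hts : TimeSupp a b (fun z : ST d => deriv φ z.1 + Λ * φ z.1) := fun z hz => by
      have := hΦs.dd none z hz
      rw [hΦ0] at this
      simp only at this
      simp only [this, hφs _ hz, mul_zero, add_zero]
    refine hts.integrableOn_cyl_smul ?_ ha hb (integrableOn_relEnt hA.continuous hη1.continuous
      hpair.smooth_G.continuous hu.locInt_A hu.locInt_η hv.cont ha hb)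
    exact ((hφ1.continuous_deriv (by norm_num)).comp continuous_fst).add
      ((hφ1.continuous.comp continuous_fst).const_mul _)
  -- The left integrand is `φ' relEnt - φ R`: the entropy inequality minus three identities of
  -- integral zero.
  have hsum := integral_mono_ae (((iη.sub i0).sub iF).sub iα) iH (by
    filter_upwards [hRle] with z hz
    have h1 := mul_le_mul_of_nonneg_left hz (hφ0 z.1)
    have h2 : dt (fun z : ST d => φ z.1) z = deriv φ z.1 := by rw [← dd_none, hΦ0]
    simp only [Pi.sub_apply, h2, ← dd_some, hΦα, hΦ0, Fintype.sum_option, flux, zero_mul, zero_add,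
      Finset.sum_const_zero, add_zero, hderiv hη1 hA1 hpair.grad_η,
      fun α => hderiv (hpair.smooth_q α) (hF1 α) (hpair.grad_q α), ← Finset.mul_sum]
    simp only [hR, inner_sub_right, Finset.sum_sub_distrib] at h1
    simp only [relEnt, inner_sub_right, Finset.sum_neg_distrib] at h1 ⊢
    linarith)
  refine le_trans ?_ hsum
  have e1 := integral_sub ((iη.sub i0).sub iF) iα
  have e2 := integral_sub (iη.sub i0) iF
  have e3 := integral_sub iη i0
  simp only [Pi.sub_apply] at e1 e2 e3 ⊢
  rw [e1, e2, e3, z0, zF, zα]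
  linarith

end

/-! ### Grönwall's argument and the initial layer. -/

section

variable {d n : ℕ}

theorem deriv_smoothTransition_nonneg (x : ℝ) : 0 ≤ deriv Real.smoothTransition x :=
  Real.smoothTransition.monotone.deriv_nonneg

theorem deriv_smoothTransition_eq_zero {x : ℝ} (hx : x ∉ Icc (0 : ℝ) 1) :
    deriv Real.smoothTransition x = 0 := by
  rcases lt_or_ge x 0 with h | h
  · have : Real.smoothTransition =ᶠ[𝓝 x] fun _ => 0 := by
      filter_upwards [Iio_mem_nhds h] with y hy using
        Real.smoothTransition.zero_of_nonpos (le_of_lt hy)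
    rw [this.deriv_eq, deriv_const]
  · have h1 : 1 < x := not_le.1 fun h' => hx ⟨h, h'⟩
    have : Real.smoothTransition =ᶠ[𝓝 x] fun _ => 1 := by
      filter_upwards [Ioi_mem_nhds h1] with y hy using
        Real.smoothTransition.one_of_one_le (le_of_lt hy)
    rw [this.deriv_eq, deriv_const]

theorem exists_deriv_smoothTransition_le : ∃ c ≥ 0, ∀ x, deriv Real.smoothTransition x ≤ c := by
  obtain ⟨c, hc⟩ := (isCompact_Icc (a := (0 : ℝ)) (b := 1)).exists_bound_of_continuousOn
    ((Real.smoothTransition.contDiff (n := 1)).continuous_deriv (by norm_num)).continuousOn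
  refine ⟨|c|, abs_nonneg _, fun x => ?_⟩
  by_cases hx : x ∈ Icc (0 : ℝ) 1
  · exact (le_abs_self _).trans ((hc x hx).trans (le_abs_self _))
  · rw [deriv_smoothTransition_eq_zero hx]; exact abs_nonneg _

/-- Cut-off functions in time adapted to Grönwall's inequality. -/
theorem exists_gronwall_cutoff {T Λ t₁ t₂ : ℝ} (hΛ : 0 ≤ Λ) (ht₂ : t₂ < T) :
    ∃ c₀ > 0, ∃ c₁ ≥ 0, ∀ a, 0 < a → 2 * a ≤ t₁ → ∃ φ : ℝ → ℝ, ∃ b < T, ContDiff ℝ ∞ φ ∧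
      (∀ t, 0 ≤ φ t) ∧ (∀ t ∉ Icc a b, φ t = 0) ∧ (∀ t ∈ Icc t₁ t₂, c₀ ≤ φ t) ∧
      ∀ t, deriv φ t + Λ * φ t ≤ - φ t + (Icc a (2 * a)).indicator (fun _ => c₁ / a) t := by
  obtain ⟨c₁, hc₁, hc⟩ := exists_deriv_smoothTransition_le
  -- Half of the room is used, so that the final cut-off `g` is 1 up to `t₂ = T - 2δ` and 0 from `T
  -- - δ` on.
  set δ := (T - t₂) / 2 with hδ
  have hδ0 : 0 < δ := by rw [hδ]; linarith
  refine ⟨Real.exp (-(Λ + 1) * t₂), Real.exp_pos _, c₁, hc₁, fun a ha hat => ?_⟩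
  set s := Real.smoothTransition with hs
  set f : ℝ → ℝ := fun t => s (t / a - 1) with hf
  set g : ℝ → ℝ := fun t => s ((T - t) / δ - 1) with hg
  have hsd : ∀ x, HasDerivAt s (deriv s x) x := fun x =>
    ((Real.smoothTransition.contDiff (n := 1)).differentiable (by norm_num) x).hasDerivAt
  have hfd : ∀ t, HasDerivAt f (deriv s (t / a - 1) * (1 / a)) t := fun t =>
    HasDerivAt.comp (h₂ := s) (h := fun t => t / a - 1) t (hsd (t / a - 1)) (((hasDerivAt_id t).div_const a).sub_const 1)
  have hgd : ∀ t, HasDerivAt g (deriv s ((T - t) / δ - 1) * (-1 / δ)) t := fun t =>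
    HasDerivAt.comp (h₂ := s) (h := fun t => (T - t) / δ - 1) t (hsd ((T - t) / δ - 1))
      ((((hasDerivAt_id t).const_sub T).div_const δ).sub_const 1)
  have hed : ∀ t, HasDerivAt (fun t : ℝ => Real.exp (-(Λ + 1) * t))
      (Real.exp (-(Λ + 1) * t) * (-(Λ + 1))) t := fun t => by
    simpa using ((hasDerivAt_id t).const_mul (-(Λ + 1))).exp
  have hf0 : ∀ t, 0 ≤ f t := fun t => Real.smoothTransition.nonneg _
  have hg0 : ∀ t, 0 ≤ g t := fun t => Real.smoothTransition.nonneg _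
  have hg1 : ∀ t, g t ≤ 1 := fun t => Real.smoothTransition.le_one _
  have hfz : ∀ t, t ≤ a → f t = 0 := fun t ht => Real.smoothTransition.zero_of_nonpos (by
    have : t / a ≤ 1 := (div_le_one ha).2 ht
    linarith)
  -- The rate `Λ + 1` absorbs `Λ φ` and leaves `-φ`. The final cut-off `g` decreases, so its
  -- derivative is dropped; that of `f` costs `c₁ / a` on `[a, 2a]`. Neither `c₀` nor `c₁` depends
  -- on `a`.
  refine ⟨fun t => Real.exp (-(Λ + 1) * t) * (f t * g t), T - δ, by linarith, ?_, fun t => ?_,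
    fun t ht => ?_, fun t ht => ?_, fun t => ?_⟩
  · have h1 : ContDiff ℝ ∞ f := Real.smoothTransition.contDiff.comp
      ((contDiff_id.div_const a).sub contDiff_const)
    have h2 : ContDiff ℝ ∞ g := Real.smoothTransition.contDiff.comp
      (((contDiff_const.sub contDiff_id).div_const δ).sub contDiff_const)
    exact (Real.contDiff_exp.comp (contDiff_const.mul contDiff_id)).mul (h1.mul h2)
  · exact mul_nonneg (Real.exp_pos _).le (mul_nonneg (hf0 t) (hg0 t))
  · rcases lt_or_ge t a with h | h
    · simp only [hfz t h.le, zero_mul, mul_zero]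
    · have h1 : g t = 0 := Real.smoothTransition.zero_of_nonpos (by
        have h2 : T - δ < t := not_le.1 fun h' => ht ⟨h, h'⟩
        have : (T - t) / δ ≤ 1 := (div_le_one hδ0).2 (by linarith)
        linarith)
      simp only [h1, mul_zero]
  · have h1 : f t = 1 := Real.smoothTransition.one_of_one_le (by
      have : 2 ≤ t / a := (le_div_iff₀ ha).2 (by linarith [ht.1])
      linarith)
    have h2 : g t = 1 := Real.smoothTransition.one_of_one_le (by
      have : 2 ≤ (T - t) / δ := (le_div_iff₀ hδ0).2 (by rw [hδ]; linarith [ht.2])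
      linarith)
    simp only [h1, h2, mul_one]
    exact Real.exp_le_exp.2 (by nlinarith [ht.2])
  · have hφd := (hed t).mul ((hfd t).mul (hgd t))
    have hφd' : deriv (fun t => Real.exp (-(Λ + 1) * t) * (f t * g t)) t = _ := hφd.deriv
    rw [hφd']
    have hgterm : 0 ≤ Real.exp (-(Λ + 1) * t) * (f t * (deriv s ((T - t) / δ - 1) * (1 / δ))) :=
      mul_nonneg (Real.exp_pos _).le (mul_nonneg (hf0 t)
        (mul_nonneg (deriv_smoothTransition_nonneg _) (by positivity)))
    have hfterm : Real.exp (-(Λ + 1) * t) * (deriv s (t / a - 1) * (1 / a) * g t) ≤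
        (Icc a (2 * a)).indicator (fun _ => c₁ / a) t := by
      by_cases ht : t ∈ Icc a (2 * a)
      · rw [indicator_of_mem ht]
        have h1 : Real.exp (-(Λ + 1) * t) ≤ 1 := Real.exp_le_one_iff.2 (by
          nlinarith [ht.1, mul_nonneg (by linarith : (0 : ℝ) ≤ Λ + 1) (ha.le.trans ht.1)])
        have h2 : deriv s (t / a - 1) * (1 / a) * g t ≤ c₁ / a := by
          calc deriv s (t / a - 1) * (1 / a) * g t ≤ deriv s (t / a - 1) * (1 / a) * 1 :=
                mul_le_mul_of_nonneg_left (hg1 t)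
                  (mul_nonneg (deriv_smoothTransition_nonneg _) (by positivity))
            _ ≤ c₁ * (1 / a) * 1 := by
                rw [mul_one, mul_one]
                exact mul_le_mul_of_nonneg_right (hc _) (by positivity)
            _ = c₁ / a := by ring
        have h3 : 0 ≤ deriv s (t / a - 1) * (1 / a) * g t :=
          mul_nonneg (mul_nonneg (deriv_smoothTransition_nonneg _) (by positivity)) (hg0 t)
        calc _ ≤ 1 * (deriv s (t / a - 1) * (1 / a) * g t) := mul_le_mul_of_nonneg_right h1 h3
          _ ≤ c₁ / a := by rw [one_mul]; exact h2
      · rw [indicator_of_notMem ht, deriv_smoothTransition_eq_zero, zero_mul, zero_mul, mul_zero]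
        intro h
        refine ht ⟨?_, ?_⟩
        · have := (one_le_div ha).1 (by linarith [h.1] : 1 ≤ t / a)
          exact this
        · exact (div_le_iff₀ ha).1 (by linarith [h.2] : t / a ≤ 2)
    have e : -1 / δ = -(1 / δ) := by ring
    rw [e]
    simp only [Pi.mul_apply]
    linarith

theorem integral_norm_rpow_le {E : Type*} [NormedAddCommGroup E] {α : Type*} [MeasurableSpace α]
    {μ : Measure α} {f : α → E} {p κ : ℝ} (hp : 0 < p) (hκ : 0 ≤ κ)
    (hf : MemLp f (ENNReal.ofReal p) μ)
    (h : eLpNorm f (ENNReal.ofReal p) μ ≤ ENNReal.ofReal κ) : ∫ x, ‖f x‖ ^ p ∂μ ≤ κ ^ p := by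
  have h0 : 0 ≤ ∫ x, ‖f x‖ ^ p ∂μ := integral_nonneg fun x => Real.rpow_nonneg (norm_nonneg _) _
  rw [hf.eLpNorm_eq_integral_rpow_norm (by simpa using hp) ENNReal.ofReal_ne_top,
    ENNReal.toReal_ofReal hp.le, ENNReal.ofReal_le_ofReal_iff hκ] at h
  calc ∫ x, ‖f x‖ ^ p ∂μ = ((∫ x, ‖f x‖ ^ p ∂μ) ^ p⁻¹) ^ p := by
        rw [← Real.rpow_mul h0, inv_mul_cancel₀ hp.ne', Real.rpow_one]
    _ ≤ κ ^ p := Real.rpow_le_rpow (Real.rpow_nonneg h0 _) h hp.le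

theorem continuousOn_slice {T : ℝ} {v : ST d → State n} (hv : ContinuousOn v (closedCyl d T))
    {t : ℝ} (ht : t ∈ Icc 0 T) : Continuous fun x : Torus d => v (t, x) := by
  rw [← continuousOn_univ]
  exact hv.comp (by fun_prop) fun x _ => ⟨ht, mem_univ _⟩

theorem memLp_of_continuous {f : Torus d → State n} (hf : Continuous f) (p : ENNReal) :
    MemLp f p volume := by
  obtain ⟨C, hC⟩ := isCompact_univ.exists_bound_of_continuousOn hf.continuousOn
  exact MemLp.of_bound hf.aestronglyMeasurable C (ae_of_all _ fun x => hC x (mem_univ _))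

/-- Compare both functions with their common initial data: `u` by continuity in `L^p`, `v` by
uniform continuity on the compact cylinder. -/
theorem tendsto_eLpNorm_sub_initial {T p : ℝ} (hT : 0 < T) (hp : 1 < p) {u v : ST d → State n}
    (hu : IsContLp T p u) (hv : ContinuousOn v (closedCyl d T))
    (h0 : ∀ᵐ x : Torus d, u (0, x) = v (0, x)) :
    Tendsto (fun t : ℝ => eLpNorm (fun x : Torus d => u (t, x) - v (t, x)) (ENNReal.ofReal p) volume)
      (𝓝[Icc 0 T] 0) (𝓝 0) := by
  have h0T : (0 : ℝ) ∈ Icc 0 T := left_mem_Icc.2 hT.le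
  have h1 := hu.cont 0 h0T
  have hvt : Tendsto (fun t : ℝ => eLpNorm (fun x : Torus d => v (0, x) - v (t, x))
      (ENNReal.ofReal p) volume) (𝓝[Icc 0 T] 0) (𝓝 0) := by
    have huc := (isCompact_slab (d := d) 0 T).uniformContinuousOn_of_continuous hv
    set V := (volume : Measure (Torus d)) univ ^ (ENNReal.ofReal p).toReal⁻¹ with hV
    have hVtop : V ≠ ⊤ := ENNReal.rpow_ne_top_of_nonneg (by positivity) (measure_ne_top _ _)
    have hlim : Tendsto (fun ε : ℝ => V * ENNReal.ofReal ε) (𝓝 0) (𝓝 0) := by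
      have := ENNReal.Tendsto.const_mul (a := V) (ENNReal.continuous_ofReal.tendsto 0)
        (Or.inr hVtop)
      simpa using this
    rw [ENNReal.tendsto_nhds_zero] at hlim ⊢
    intro κ hκ
    obtain ⟨r, hr, hrκ⟩ := Metric.eventually_nhds_iff.1 (hlim κ hκ)
    obtain ⟨δ, hδ, hd⟩ := Metric.uniformContinuousOn_iff.1 huc (r / 2) (by positivity)
    filter_upwards [self_mem_nhdsWithin, mem_nhdsWithin_of_mem_nhds (Metric.ball_mem_nhds 0 hδ)]
      with t ht htδ
    refine (eLpNorm_le_of_ae_bound (C := r / 2) (ae_of_all _ fun x => ?_)).trans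
      (hrκ (y := r / 2) (by rw [Real.dist_0_eq_abs, abs_of_pos (by positivity)]; linarith))
    rw [← dist_eq_norm]
    refine (hd (0, x) ⟨h0T, mem_univ _⟩ (t, x) ⟨ht, mem_univ _⟩ ?_).le
    rw [Prod.dist_eq, dist_self, dist_comm]
    simpa using htδ
  have hsum := h1.add hvt
  rw [add_zero] at hsum
  refine tendsto_of_tendsto_of_tendsto_of_le_of_le' tendsto_const_nhds hsum
    (Eventually.of_forall fun _ => zero_le) ?_
  filter_upwards [self_mem_nhdsWithin] with t ht
  have hu' := fun t ht => (hu.memLp t ht).aestronglyMeasurable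
  have hv' := fun t ht => (continuousOn_slice hv (t := t) ht).aestronglyMeasurable
    (μ := (volume : Measure (Torus d)))
  have hp1 : 1 ≤ ENNReal.ofReal p := by
    rw [← ENNReal.ofReal_one]; exact ENNReal.ofReal_le_ofReal hp.le
  refine le_trans (le_of_eq (eLpNorm_congr_ae ?_)) (eLpNorm_add_le
    ((hu' t ht).sub (hu' 0 h0T)) ((hv' 0 h0T).sub (hv' t ht)) hp1)
  filter_upwards [h0] with x hx
  simp [hx]

/-- The relative entropy vanishes in the mean at the initial time. -/
theorem eventually_integral_slab_relEnt_le {T p : ℝ} (hT : 0 < T) (hp : 1 < p)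
    {A G : State n → State n} {η : State n → ℝ} {u v : ST d → State n}
    (hu : IsContLp T p u) (hv : ContinuousOn v (closedCyl d T))
    (h0 : ∀ᵐ x : Torus d, u (0, x) = v (0, x))
    (hH0 : ∀ z ∈ closedCyl d T, ∀ u, 0 ≤ relEnt A η G u (v z))
    (hH : ∀ ε > 0, ∃ C ≥ 0, ∀ z ∈ closedCyl d T, ∀ u, relEnt A η G u (v z) ≤
      ε + C * ‖u - v z‖ ^ p)
    (hint : ∀ a b, 0 < a → b < T →
      IntegrableOn (fun z => relEnt A η G (u z) (v z)) (slab d a b))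
    {κ : ℝ} (hκ : 0 < κ) : ∃ τ > 0, ∀ a, 0 < a → a < τ →
      ∫ z in slab d a (2 * a), relEnt A η G (u z) (v z) ≤ κ * a := by
  have hp0 : 0 < p := by linarith
  set V := (volume : Measure (Torus d)).real univ with hV
  have hV0 : 0 ≤ V := measureReal_nonneg
  -- The budget `κ` per time slice is split equally: the constant term contributes at most `κ / 2`
  -- over the volume `V`, and the `L^p` term at most `C ρ^p ≤ κ / 2`.
  obtain ⟨C, hC0, hC⟩ := hH (κ / (2 * (V + 1))) (by positivity)
  obtain ⟨ρ, hρ0, hρ⟩ : ∃ ρ > 0, C * ρ ^ p ≤ κ / 2 := by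
    have hlim : Tendsto (fun ρ : ℝ => C * ρ ^ p) (𝓝 0) (𝓝 0) := by
      have := ((Real.continuousAt_rpow_const 0 p (Or.inr hp0.le)).tendsto).const_mul C
      simpa [Real.zero_rpow hp0.ne'] using this
    obtain ⟨r, hr, h⟩ := Metric.eventually_nhds_iff.1
      (hlim.eventually (ge_mem_nhds (half_pos hκ)))
    exact ⟨r / 2, by positivity, h (by
      rw [Real.dist_0_eq_abs, abs_of_pos (by positivity)]; linarith)⟩
  have hev := (ENNReal.tendsto_nhds_zero.1 (tendsto_eLpNorm_sub_initial hT hp hu hv h0))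
    (ENNReal.ofReal ρ) (by simpa using hρ0)
  rw [eventually_nhdsWithin_iff] at hev
  obtain ⟨δ, hδ, hball⟩ := Metric.eventually_nhds_iff.1 hev
  refine ⟨min (δ / 2) (T / 2), by positivity, fun a ha haτ => ?_⟩
  have h2aδ : 2 * a < δ := by linarith [min_le_left (δ / 2) (T / 2)]
  have h2aT : 2 * a < T := by linarith [min_le_right (δ / 2) (T / 2)]
  have hslice : ∀ t ∈ Icc a (2 * a), ‖∫ x : Torus d, relEnt A η G (u (t, x)) (v (t, x))‖ ≤ κ := by
    intro t ht
    have htT : t ∈ Icc 0 T := ⟨ha.le.trans ht.1, ht.2.trans h2aT.le⟩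
    have hzc : ∀ x : Torus d, ((t, x) : ST d) ∈ closedCyl d T := fun x => ⟨htT, mem_univ _⟩
    have hmem : MemLp (fun x : Torus d => u (t, x) - v (t, x)) (ENNReal.ofReal p) volume :=
      (hu.memLp t htT).sub (memLp_of_continuous (continuousOn_slice hv htT) _)
    have hle := hball (y := t) (by
      rw [Real.dist_0_eq_abs, abs_of_nonneg htT.1]; linarith [ht.2]) htT
    have hI := integral_norm_rpow_le hp0 hρ0.le hmem hle
    have hIi : Integrable (fun x : Torus d => ‖u (t, x) - v (t, x)‖ ^ p) := by
      have := hmem.integrable_norm_rpow (by simpa using hp0) ENNReal.ofReal_ne_top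
      rwa [ENNReal.toReal_ofReal hp0.le] at this
    rw [Real.norm_of_nonneg (integral_nonneg fun x => hH0 _ (hzc x) _)]
    calc ∫ x : Torus d, relEnt A η G (u (t, x)) (v (t, x))
        ≤ ∫ x : Torus d, (κ / (2 * (V + 1)) + C * ‖u (t, x) - v (t, x)‖ ^ p) :=
          integral_mono_of_nonneg (ae_of_all _ fun x => hH0 _ (hzc x) _)
            ((integrable_const _).add (hIi.const_mul C)) (ae_of_all _ fun x => hC _ (hzc x) _)
      _ = V * (κ / (2 * (V + 1))) + C * ∫ x : Torus d, ‖u (t, x) - v (t, x)‖ ^ p := by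
          rw [integral_add (integrable_const _) (hIi.const_mul C), integral_const,
            integral_const_mul, smul_eq_mul]
      _ ≤ κ / 2 + κ / 2 := by
          refine add_le_add ?_ ((mul_le_mul_of_nonneg_left hI hC0).trans hρ)
          rw [← mul_div_assoc, div_le_div_iff₀ (by positivity) (by norm_num)]
          nlinarith
      _ = κ := by ring
  have e : ∫ z in slab d a (2 * a), relEnt A η G (u z) (v z) =
      ∫ t in Icc a (2 * a), ∫ x : Torus d, relEnt A η G (u (t, x)) (v (t, x)) := by
    have := setIntegral_prod (μ := (volume : Measure ℝ)) (ν := (volume : Measure (Torus d)))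
      (fun z => relEnt A η G (u z) (v z)) (hint a (2 * a) ha h2aT)
    simp only [Measure.restrict_univ] at this
    exact this
  rw [e]
  refine (le_abs_self _).trans ((norm_setIntegral_le_of_norm_le_const measure_Icc_lt_top
    hslice).trans (le_of_eq ?_))
  rw [Real.volume_real_Icc_of_le (by linarith)]
  ring

/-- Grönwall's inequality for the relative entropy, in weak form. -/
theorem setIntegral_slab_eq_zero {T Λ : ℝ} (hΛ : 0 ≤ Λ) {H : ST d → ℝ}
    (hH0 : ∀ z ∈ cyl d T, 0 ≤ H z)
    (hint : ∀ a b, 0 < a → b < T → IntegrableOn H (slab d a b))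
    (hineq : ∀ φ : ℝ → ℝ, ContDiff ℝ ∞ φ → (∀ t, 0 ≤ φ t) → ∀ a b, 0 < a → b < T →
      (∀ t ∉ Icc a b, φ t = 0) → 0 ≤ ∫ z in cyl d T, (deriv φ z.1 + Λ * φ z.1) * H z)
    (hinit : ∀ κ > 0, ∃ τ > 0, ∀ a, 0 < a → a < τ → ∫ z in slab d a (2 * a), H z ≤ κ * a)
    {t₁ t₂ : ℝ} (ht₁ : 0 < t₁) (ht₂ : t₂ < T) : ∫ z in slab d t₁ t₂, H z = 0 := by
  by_cases h12 : t₁ ≤ t₂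
  swap
  · simp [slab, Icc_eq_empty h12]
  obtain ⟨c₀, hc₀, c₁, hc₁, hcut⟩ := exists_gronwall_cutoff (t₁ := t₁) hΛ ht₂
  have hI0 : 0 ≤ ∫ z in slab d t₁ t₂, H z :=
    setIntegral_nonneg (measurableSet_slab _ _) fun z hz => hH0 z (slab_subset_cyl ht₁ ht₂ hz)
  refine le_antisymm (le_of_forall_pos_le_add fun ε hε => ?_) hI0
  rw [zero_add]
  -- The cut-off costs `c₁ / a` on a slab where `H` integrates to at most `κ a`; the factors `a`
  -- cancel and `c₁ κ ≤ ε c₀`.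
  set κ := ε * c₀ / (c₁ + 1) with hκ
  obtain ⟨τ, hτ, hτκ⟩ := hinit κ (by positivity)
  obtain ⟨a, ha, haτ, hat⟩ : ∃ a, 0 < a ∧ a < τ ∧ 2 * a ≤ t₁ :=
    ⟨min (τ / 2) (t₁ / 2), by positivity, by linarith [min_le_left (τ / 2) (t₁ / 2)],
      by linarith [min_le_right (τ / 2) (t₁ / 2)]⟩
  have h2aT : 2 * a < T := by linarith
  obtain ⟨φ, b, hb, hφ, hφ0, hφs, hφc, hφd⟩ := hcut a ha hat
  have hΦs : TimeSupp a b (fun z : ST d => φ z.1) := fun z hz => hφs _ hz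
  have hφ1 : ContDiff ℝ 1 φ := hφ.of_le (by exact_mod_cast le_top)
  have iφH : IntegrableOn (fun z => φ z.1 * H z) (cyl d T) :=
    hΦs.integrableOn_cyl_smul (hφ1.continuous.comp continuous_fst) ha hb (hint a b ha hb)
  have iSlab : ∀ a b c : ℝ, 0 < a → b < T →
      IntegrableOn ((slab d a b).indicator fun z => c * H z) (cyl d T) := fun a b c ha hb =>
    ((integrable_indicator_iff (measurableSet_slab a b)).2
      ((hint a b ha hb).const_mul c)).integrableOn
  have sSlab : ∀ a b c : ℝ, 0 < a → b < T →
      ∫ z in cyl d T, (slab d a b).indicator (fun z => c * H z) z = c * ∫ z in slab d a b, H z :=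
    fun a b c ha hb => by
      rw [setIntegral_indicator (measurableSet_slab a b),
        inter_eq_right.2 (slab_subset_cyl ha hb), integral_const_mul]
  have h1 : ∫ z in cyl d T, (deriv φ z.1 + Λ * φ z.1) * H z ≤
      ∫ z in cyl d T, ((slab d a (2 * a)).indicator (fun z => c₁ / a * H z) z - φ z.1 * H z) := by
    have hts : TimeSupp a b (fun z : ST d => deriv φ z.1 + Λ * φ z.1) := fun z hz => by
      have := hΦs.dd none z hz
      rw [(isC1_time hφ1).2.1] at this
      simp only at this
      simp only [this, hφs _ hz, mul_zero, add_zero]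
    refine setIntegral_mono_on (hts.integrableOn_cyl_smul ?_ ha hb (hint a b ha hb))
      ((iSlab _ _ _ ha h2aT).sub iφH) (measurableSet_cyl T) fun z hz => ?_
    · exact ((hφ1.continuous_deriv (by norm_num)).comp continuous_fst).add
        ((hφ1.continuous.comp continuous_fst).const_mul _)
    · have h2 := mul_le_mul_of_nonneg_right (hφd z.1) (hH0 z hz)
      refine h2.trans (le_of_eq ?_)
      by_cases hs : z.1 ∈ Icc a (2 * a)
      · rw [indicator_of_mem hs, indicator_of_mem (mem_slab.2 hs)]; ring
      · rw [indicator_of_notMem hs, indicator_of_notMem fun h => hs (mem_slab.1 h)]; ring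
  have h2 := (hineq φ hφ hφ0 a b ha hb hφs).trans h1
  rw [integral_sub (iSlab _ _ _ ha h2aT) iφH, sSlab _ _ _ ha h2aT] at h2
  have h3 : c₀ * ∫ z in slab d t₁ t₂, H z ≤ ∫ z in cyl d T, φ z.1 * H z := by
    rw [← sSlab _ _ _ ht₁ ht₂]
    refine setIntegral_mono_on (iSlab _ _ _ ht₁ ht₂) iφH (measurableSet_cyl T) fun z hz => ?_
    by_cases hs : z ∈ slab d t₁ t₂
    · rw [indicator_of_mem hs]
      exact mul_le_mul_of_nonneg_right (hφc _ (mem_slab.1 hs)) (hH0 z hz)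
    · rw [indicator_of_notMem hs]
      exact mul_nonneg (hφ0 _) (hH0 z hz)
  have h4 : c₁ / a * ∫ z in slab d a (2 * a), H z ≤ c₁ * κ := by
    refine (mul_le_mul_of_nonneg_left (hτκ a ha haτ) (by positivity)).trans (le_of_eq ?_)
    field_simp
  have h5 : c₁ * κ ≤ ε * c₀ := by
    rw [hκ, ← mul_div_assoc, div_le_iff₀ (by positivity)]
    nlinarith [mul_pos hε hc₀]
  have h6 : c₀ * ∫ z in slab d t₁ t₂, H z ≤ c₀ * ε := by linarith
  exact le_of_mul_le_mul_left h6 hc₀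

/-- Countably many slabs exhaust the open cylinder, and the initial time slice is a null set. -/
theorem ae_cyl_of_ae_slab {T : ℝ} {P : ST d → Prop}
    (h : ∀ t₁ t₂, 0 < t₁ → t₂ < T → ∀ᵐ z ∂(volume.restrict (slab d t₁ t₂)), P z) :
    ∀ᵐ z ∂(volume.restrict (cyl d T)), P z := by
  have h1 : ∀ k : ℕ, ∀ᵐ z, z ∈ slab d (1 / ((k : ℝ) + 1)) (T - 1 / ((k : ℝ) + 1)) → P z := fun k =>
    (ae_restrict_iff' (measurableSet_slab _ _)).1 (h _ _ (by positivity)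
      (sub_lt_self _ (by positivity)))
  have h2 : ∀ᵐ z : ST d, z.1 ≠ 0 := by
    rw [ae_iff]
    have e : {z : ST d | ¬ z.1 ≠ 0} = {(0 : ℝ)} ×ˢ univ := by ext z; simp
    rw [e]
    change (volume.prod volume) ({(0 : ℝ)} ×ˢ (univ : Set (Torus d))) = 0
    rw [Measure.prod_prod, Real.volume_singleton, zero_mul]
  rw [ae_restrict_iff' (measurableSet_cyl T)]
  filter_upwards [ae_all_iff.2 h1, h2] with z hz hz0 hzT
  have hz1 : 0 < z.1 := lt_of_le_of_ne hzT.1.1 (Ne.symm hz0)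
  obtain ⟨k, hk⟩ := ((eventually_one_div_lt hz1).and
    (eventually_one_div_lt (sub_pos.2 hzT.1.2))).exists
  exact hz k (mem_slab.2 ⟨hk.1.le, by linarith [hk.2]⟩)

end

end HypCL

/-! ### The uniqueness theorem. -/

open HypCL
theorem mainTheorem9 {n d : ℕ} {T p : ℝ} (hT : 0 < T) (hp : 1 < p)
    (A : State n → State n) (F : Fin d → State n → State n)
    (η : State n → ℝ) (q : Fin d → State n → ℝ) (G : State n → State n)
    (hA : ContDiff ℝ 2 A) (hF : ∀ α, ContDiff ℝ 2 (F α))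
    (hA_inj : Function.Injective A)
    (hA_nonsing : ∀ u, Function.Bijective (fderiv ℝ A u))
    (h_pair : IsEntropyPair A F η q G)
    (h_posdef : ∀ u ξ, ξ ≠ 0 →
      0 < fderiv ℝ (fderiv ℝ η) u ξ ξ - inner ℝ (G u) (fderiv ℝ (fderiv ℝ A) u ξ ξ))
    (hη_nonneg : ∀ u, 0 ≤ η u)
    (h_growth_η : ∃ β₁ β₂ B : ℝ, 0 < β₁ ∧ 0 < β₂ ∧ 0 < B ∧
      ∀ u, β₁ * (‖u‖ ^ p + 1) - B ≤ η u ∧ η u ≤ β₂ * (‖u‖ ^ p + 1))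
    (h_growth_F : ∀ α, Asymptotics.IsLittleO (Bornology.cobounded (State n)) (F α) η)
    (h_growth_A : Asymptotics.IsLittleO (Bornology.cobounded (State n)) A η)
    (h_growth_H : ∃ r C B : ℝ, 1 < r ∧ 0 < C ∧ 0 < B ∧
      ∀ u, 1 / C * (‖A u‖ ^ r + 1) - B ≤ η u ∧ η u ≤ C * (‖A u‖ ^ r + 1))
    (u ubar : ℝ × Torus d → State n)
    (hu_cont : IsContLp T p u)
    (hu : IsEntropyWeakSolution T A F η q u)
    (hubar : IsStrongSolution T A F ubar)
    (h_init : ∀ᵐ x : Torus d, u (0, x) = ubar (0, x)) :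
    ∀ᵐ z ∂(volume.restrict (cyl d T)), u z = ubar z := by
  have hp0 : 0 < p := by linarith
  obtain ⟨β₁, β₂, B, hβ₁, hβ₂, -, hgη⟩ := h_growth_η
  obtain ⟨r, C, _, hr, hC, -, hgA⟩ := h_growth_H
  have hηtop := tendsto_atTop_of_rpow_growth hp0 hβ₁ fun u => (hgη u).1
  have hAtop := tendsto_norm_of_le_rpow (by linarith) hC (fun u => (hgA u).2) hηtop
  obtain ⟨S, hS, hSA, hAS⟩ := exists_contDiff_inverse hA hA_inj hA_nonsing hAtop
  have hK : IsCompact (ubar '' closedCyl d T) := (isCompact_slab 0 T).image_of_continuousOn hubar.cont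
  have hmem : ∀ z ∈ closedCyl d T, ubar z ∈ ubar '' closedCyl d T := fun z hz =>
    mem_image_of_mem _ hz
  have hbound := fun {F : State n → State n} (hF : ContDiff ℝ 2 F)
    (hFo : Asymptotics.IsLittleO (Bornology.cobounded (State n)) F η) =>
    exists_norm_remainder_le_relEnt hA hS hSA hAS hF h_pair.smooth_η h_pair.smooth_G
      h_pair.grad_η h_posdef hη_nonneg hηtop hFo h_growth_A hK
  -- Taking `A` itself as the vector field yields positivity and definiteness of `relEnt` without
  -- needing an index `α`, hence also for `d = 0`.
  obtain ⟨_, -, hH⟩ := hbound hA h_growth_A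
  choose c hc0 hc using fun α => hbound (hF α) (h_growth_F α)
  obtain ⟨w, hw, hweq⟩ := hubar.exists_hasWeakGrad
  have hAc := hA.continuous
  have hηc := h_pair.smooth_η.continuous
  have hGc := h_pair.smooth_G.continuous
  have hH0 : ∀ z ∈ closedCyl d T, ∀ u, 0 ≤ relEnt A η G u (ubar z) := fun z hz u =>
    (hH _ (hmem z hz) u).1
  have hint := fun a b (ha : 0 < a) (hb : b < T) =>
    integrableOn_relEnt hAc hηc hGc hu.locInt_A hu.locInt_η hubar.cont ha hb
  obtain ⟨Λ, hΛ, hineq⟩ := integral_relEnt_nonneg hA hF h_pair hu hw hweq (S := S)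
    (fun v ξ => by simpa only [hSA] using fderiv_comp_inverse hA hS hAS (A v) ξ) hc0
    fun α z hz u => (hc α _ (hmem z hz) u).2.2
  refine ae_cyl_of_ae_slab fun t₁ t₂ ht₁ ht₂ => ?_
  have hcyl := slab_subset_cyl (d := d) ht₁ ht₂
  have hzero := setIntegral_slab_eq_zero hΛ
    (fun z hz => hH0 z (cyl_subset_closedCyl T hz) (u z)) hint hineq
    (fun κ hκ => eventually_integral_slab_relEnt_le hT hp hu_cont hubar.cont h_init hH0
      (fun ε hε => by
        obtain ⟨c, hc, h⟩ := exists_relEnt_le_rpow hAc hηc hGc hη_nonneg h_growth_A hp0 hβ₂.le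
          (fun u => (hgη u).2) hK hε
        exact ⟨c, hc, fun z hz u => h _ (hmem z hz) u⟩) hint hκ) ht₁ ht₂
  -- A nonnegative function with zero integral vanishes almost everywhere, and definiteness of
  -- `relEnt` concludes.
  have hz := (setIntegral_eq_zero_iff_of_nonneg_ae (by
    filter_upwards [ae_restrict_mem (measurableSet_slab t₁ t₂)] with z hz
    exact hH0 z (cyl_subset_closedCyl T (hcyl hz)) (u z)) (hint t₁ t₂ ht₁ ht₂)).1 hzero
  filter_upwards [hz, ae_restrict_mem (measurableSet_slab t₁ t₂)] with z h1 h2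
  exact (hH _ (hmem z (cyl_subset_closedCyl T (hcyl h2))) (u z)).2.1 h1
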